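/- Let $P\subset\mathbb E^d$ be a $d$-dimensional convex polytope, and let $\mathcal T_P$ be a normal (face-to-face) tiling of $\mathbb E^d$ by translates of $P$, so that $P$ is a parallelohedron. Let $s$ be a translation-invariant canonical scaling of $\mathcal T_P$. That is, $s$ is a positive function on the $(d-1)$-faces (facets) of the tiling such that * $s(F+v)=s(F)$ for every facet $F$ and every translation $v$ preserving $\mathcal T_P$, and * for every $(d-2)$-face $R$ of the tiling, $\sum_i s(F_i)\mathbf n_i=0$, where $F_1,\dots,F_k$ are all facets of the tiling containing $R$ and $\mathbf n_i$ are their unit normals chosen consistently with one direction of going around $R$. Fix a tile $P_0$. The generatrix $\mathcal G_P\subset\mathbb E^d\times\mathbb R$ is the union of the lifts of tiles obtained along all chains of tiles, consecutive ones sharing a facet, that start at $P_0$. Here $P_0$ is lifted to $P_0\times\{0\}$, with normal $(\mathbf 0,-1)$. If $P_j$ shares a facet with $P_i$, and $\widetilde P_i$ is a lift of $P_i$ with normal $(\mathbf v,-1)$, then $P_j$ is lifted to the polytope $\widetilde P_j$ that projects onto $P_j$, has normal $(\mathbf v+s(P_i\cap P_j)\,\mathbf n_{i,j},-1)$, and meets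 $\widetilde P_i$ in a set projecting onto $P_i\cap P_j$; here $\mathbf n_{i,j}$ is the unit normal to $P_i\cap P_j$ directed from $P_i$ to $P_j$. Then every tile has a centre of symmetry, $\mathcal G_P$ is the graph of a function $G:\mathbb E^d\to\mathbb R$, and there is a positive definite symmetric matrix $Q$ with the following properties, where $c$ is the centre of $P_0$ and $Q(x)=\tfrac12x^{T}Qx$: 1. For every tile $A$ sharing a facet with $P_0$, with centre $a$, one has $s(P_0\cap A)\,\mathbf n=Q(a-c)$, where $\mathbf n$ is the unit normal to $P_0\cap A$ directed from $P_0$ to $A$. 2. The elliptic paraboloid $\Pi_P=\{(x,Q(x-c)) : x\in\mathbb E^d\}$ is inscribed in $\mathcal G_P$: $G(x)\le Q(x-c)$ for all $x$. 3. $G(x)=Q(x-c)$ if and only if $x$ is the centre of a tile. 4. Above the centre $x$ of every tile the two surfaces are tangent: $G$ and $y\mapsto Q(y-c)$ are differentiable at $x$ with the common gradient $Q\cdot(x-c)$. -/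

import Mathlib

open scoped InnerProductSpace Pointwise

noncomputable section

namespace ParTiling

/-- The Euclidean space of dimension `d`. -/
abbrev E (d : ℕ) : Type := EuclideanSpace ℝ (Fin d)

variable {d : ℕ}

/-- A `d`-dimensional convex polytope in `E d`. -/
def IsFullPolytope (P : Set (E d)) : Prop :=
  (∃ V : Set (E d), V.Finite ∧ P = convexHull ℝ V) ∧ (interior P).Nonempty

/-- `T` is a normal (face-to-face) tiling of the space by translates of the polytope `P`, so that
`P` is a parallelohedron. The empty set and the polytope itself count as faces here. -/
structure IsParallelohedralTiling (P : Set (E d)) (T : Set (Set (E d))) : Prop where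
  polytope : IsFullPolytope P
  translates : ∀ A ∈ T, ∃ v : E d, A = v +ᵥ P
  covers : ⋃₀ T = Set.univ
  face_to_face : ∀ A ∈ T, ∀ B ∈ T, IsExposed ℝ A (A ∩ B) ∧ IsExposed ℝ B (A ∩ B)

/-- Dimension of (the affine hull of) a nonempty set. -/
def dim (F : Set (E d)) : ℕ := Module.finrank ℝ (vectorSpan ℝ F)

/-- `F` is a nonempty face of some tile of `T`. -/
def IsFaceOf (T : Set (Set (E d))) (F : Set (E d)) : Prop :=
  F.Nonempty ∧ ∃ A ∈ T, IsExposed ℝ A F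

/-- `(d-1)`-dimensional faces of the tiling. -/
def IsFacet (T : Set (Set (E d))) (F : Set (E d)) : Prop := IsFaceOf T F ∧ dim F + 1 = d

/-- `(d-2)`-dimensional faces of the tiling. -/
def IsRidge (T : Set (Set (E d))) (R : Set (E d)) : Prop := IsFaceOf T R ∧ dim R + 2 = d

/-- The linear subspace orthogonal to `R`; it is two-dimensional if `R` is a ridge. -/
abbrev normalSpace (R : Set (E d)) : Submodule ℝ (E d) := (vectorSpan ℝ R)ᗮ

/-- `u` is the unit vector, orthogonal to the ridge `R`, along which the facet `F` containing `R`
leaves `R`: the projection of `F` to the plane orthogonal to `R` lies on the ray from the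
projection of `R` in the direction `u`. -/
def IsRayDirection (R F : Set (E d)) (u : normalSpace R) : Prop :=
  ‖u‖ = 1 ∧ (u : E d) ∈ vectorSpan ℝ F ∧ ∀ x ∈ F, ∀ r ∈ R, 0 ≤ ⟪(u : E d), x - r⟫_ℝ

/-- The torsion of `s` around the ridge `R`: the sum of `s F • n F` over all facets `F` of the
tiling that contain `R`, where `n F` are unit normals that agree with one direction of traversal
around `R`. The direction of traversal is a quarter turn `J` of the plane orthogonal to `R`, and
`n F = J (u F)`, where `u F` is the direction in which `F` leaves `R`. -/
def torsion (T : Set (Set (E d))) (s : Set (E d) → ℝ) (R : Set (E d))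
    (J : normalSpace R →ₗᵢ[ℝ] normalSpace R) (u : Set (E d) → normalSpace R) : E d :=
  ∑ᶠ F ∈ {F : Set (E d) | IsFacet T F ∧ R ⊆ F}, s F • ((J (u F) : normalSpace R) : E d)

/-- A canonical scaling: positive on the facets, with zero torsion around every ridge (for both
directions of traversal `J`). Only the values of `s` on facets of `T` matter. -/
structure IsCanonicalScaling (T : Set (Set (E d))) (s : Set (E d) → ℝ) : Prop where
  pos : ∀ F, IsFacet T F → 0 < s F
  torsion_eq_zero : ∀ R, IsRidge T R →
    ∀ J : normalSpace R →ₗᵢ[ℝ] normalSpace R, (∀ w, ⟪J w, w⟫_ℝ = 0) →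
    ∀ u : Set (E d) → normalSpace R,
      (∀ F, IsFacet T F → R ⊆ F → IsRayDirection R F (u F)) → torsion T s R J u = 0

/-- Invariance of the scaling under all translations that preserve the tiling. -/
def IsTranslationInvariant (T : Set (Set (E d))) (s : Set (E d) → ℝ) : Prop :=
  ∀ v : E d, (fun A : Set (E d) => v +ᵥ A) '' T = T → ∀ F, IsFacet T F → s (v +ᵥ F) = s F

/-- Two tiles are adjacent if they share a facet. -/
def Adjacent (T : Set (Set (E d))) (A B : Set (E d)) : Prop :=
  A ∈ T ∧ B ∈ T ∧ A ≠ B ∧ IsFacet T (A ∩ B)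

/-- `n` is the unit normal to the common facet of `A` and `B`, directed from `A` to `B`. -/
def IsUnitNormal (A B : Set (E d)) (n : E d) : Prop :=
  ‖n‖ = 1 ∧ n ∈ (vectorSpan ℝ (A ∩ B))ᗮ ∧ ∀ a ∈ A, ∀ b ∈ B, ⟪n, a⟫_ℝ ≤ ⟪n, b⟫_ℝ

/-- `L`, a subset of the extended space `E d × ℝ`, is a lift of the tile `A` with normal
`(v, -1)`: it projects onto `A` and is orthogonal to `(v, -1)`. -/
def IsLift (A : Set (E d)) (L : Set (E d × ℝ)) (v : E d) : Prop :=
  Prod.fst '' L = A ∧ ∀ p ∈ L, ∀ q ∈ L, ⟪v, p.1 - q.1⟫_ℝ + (-1) * (p.2 - q.2) = 0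

/-- `GenFace T s P₀ A L v`: there is a chain of tiles from `P₀` to `A` for which the successive
lifting gives the lift `L` of `A`, with normal `(v, -1)`. The tile `P₀` is lifted to itself with
normal `(0, -1)`; a tile `B` adjacent to `A` is lifted up to the lift `L` of `A` (the two lifts
meet in a lift of `A ∩ B`), and the normal increases by `s (A ∩ B) • n`. -/
inductive GenFace (T : Set (Set (E d))) (s : Set (E d) → ℝ) (P₀ : Set (E d)) :
    Set (E d) → Set (E d × ℝ) → E d → Prop
  | base : GenFace T s P₀ P₀ (P₀ ×ˢ {0}) 0
  | step {A B : Set (E d)} {L L' : Set (E d × ℝ)} {v n : E d} :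
      GenFace T s P₀ A L v → Adjacent T A B → IsUnitNormal A B n →
      IsLift B L' (v + s (A ∩ B) • n) → Prod.fst '' (L ∩ L') = A ∩ B →
      GenFace T s P₀ B L' (v + s (A ∩ B) • n)

/-- The generatrix: the union of all lifted tiles. -/
def generatrix (T : Set (Set (E d))) (s : Set (E d) → ℝ) (P₀ : Set (E d)) : Set (E d × ℝ) :=
  {p | ∃ A L v, GenFace T s P₀ A L v ∧ p ∈ L}

/-- `c` is a centre of symmetry of `A`. -/
def IsCenter (A : Set (E d)) (c : E d) : Prop := ∀ x ∈ A, c + (c - x) ∈ A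

/-- The quadratic form `½ xᵀ Q x`. -/
def quadForm (Q : Matrix (Fin d) (Fin d) ℝ) (x : E d) : ℝ :=
  1 / 2 * ⟪x, Matrix.toEuclideanLin Q x⟫_ℝ

end ParTiling

end

open ParTiling

noncomputable section

namespace ParTiling

variable {d : ℕ}

/-! ### Tiles -/

/-! Lifting is integration of a discrete 1-form: crossing the facet `A ∩ B` adds the affine function
`jump s A B`, which vanishes on that facet and has gradient `s (A ∩ B) • n`. Zero torsion says that
the jumps around a ridge sum to zero, so the form is exact near every point whose minimal face has
codimension at most two (`exists_isPotentialAt`). Faces of higher codimension are missed by generic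
segments and triangles, and on a compact convex set that misses them the local potentials glue
(`isExactOn_of_convex`). Comparing triangles with a common vertex in `P₀` then gives a global
potential `Φ` (`exists_potential`): affine functions on the tiles that agree wherever tiles meet.
Their graph is the generatrix.

Positivity of `s` makes this function convex: at `x` the largest affine functions are those of the
tiles containing `x`, and only those (`affineEval_lt`). The tiling is a lattice tiling
(`exists_translation`), and invariance of `s` turns `v ↦ Φ (v +ᵥ P₀)` into a cocycle on the lattice.
Hence the gradient is additive in `v`, so equal to `L v` for a linear `L`, and the constant term is
quadratic in `v`; commutativity of addition makes `L` symmetric (`exists_quadratic`). Convexity and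
boundedness of `P₀` make `L` positive definite, hence invertible, so the linear part of the constant
term is absorbed into a point `c`.

The affine pieces are now `⟪L v, x - c⟫ - ½ ⟪L v, v⟫`, the tangents to the paraboloid above the
points `v + c`. The tile `P₀` is where all of them are nonpositive, which is symmetric about `c`
because `v` and `-v` both occur. Completing the square gives `G x = Q(x - c) - Q(x - (v + c))` on `v
+ᵥ P₀`, and contact, inscription and tangency can be read off. -/

lemma _root_.IsExposed.eq_of_inter_interior_nonempty {A F : Set (E d)} (h : IsExposed ℝ A F)
    (hi : (F ∩ interior A).Nonempty) : F = A := by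
  obtain ⟨x, hxF, hxA⟩ := hi
  obtain ⟨l, rfl⟩ := h ⟨x, hxF⟩
  have hl : l = 0 := by
    have : IsLocalMax l x := by
      filter_upwards [isOpen_interior.mem_nhds hxA] with y hy using hxF.2 y (interior_subset hy)
    simpa using this.fderiv_eq_zero
  ext y
  simp [hl]

section Tiling

variable {P : Set (E d)} {T : Set (Set (E d))}

lemma IsFullPolytope.isCompact (h : IsFullPolytope P) : IsCompact P := by
  obtain ⟨⟨V, hV, rfl⟩, -⟩ := h
  exact hV.isCompact_convexHull ℝ

lemma IsFullPolytope.convex (h : IsFullPolytope P) : Convex ℝ P := by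
  obtain ⟨⟨V, hV, rfl⟩, -⟩ := h
  exact convex_convexHull ℝ V

namespace IsParallelohedralTiling

variable {A B C : Set (E d)}

lemma isCompact (hT : IsParallelohedralTiling P T) (hA : A ∈ T) : IsCompact A := by
  obtain ⟨v, rfl⟩ := hT.translates A hA
  exact hT.polytope.isCompact.vadd v

lemma convex (hT : IsParallelohedralTiling P T) (hA : A ∈ T) : Convex ℝ A := by
  obtain ⟨v, rfl⟩ := hT.translates A hA
  exact hT.polytope.convex.vadd v

lemma isClosed (hT : IsParallelohedralTiling P T) (hA : A ∈ T) : IsClosed A :=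
  (hT.isCompact hA).isClosed

lemma interior_nonempty (hT : IsParallelohedralTiling P T) (hA : A ∈ T) :
    (interior A).Nonempty := by
  obtain ⟨v, rfl⟩ := hT.translates A hA
  rw [interior_vadd]
  exact hT.polytope.2.vadd_set

lemma nonempty (hT : IsParallelohedralTiling P T) (hA : A ∈ T) : A.Nonempty :=
  (hT.interior_nonempty hA).mono interior_subset

lemma subset_closure_interior (hT : IsParallelohedralTiling P T) (hA : A ∈ T) :
    A ⊆ closure (interior A) := by
  rw [(hT.convex hA).closure_interior_eq_closure_of_nonempty_interior (hT.interior_nonempty hA)]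
  exact subset_closure

lemma inter_interior_nonempty (hT : IsParallelohedralTiling P T) (hA : A ∈ T) {O : Set (E d)}
    (hO : IsOpen O) (h : (A ∩ O).Nonempty) : (interior A ∩ O).Nonempty := by
  obtain ⟨x, hxA, hxO⟩ := h
  obtain ⟨y, hyO, hyA⟩ := mem_closure_iff.1 (hT.subset_closure_interior hA hxA) O hO hxO
  exact ⟨y, hyA, hyO⟩

/-- Distinct tiles do not overlap. -/
lemma eq_of_mem_interior (hT : IsParallelohedralTiling P T) (hA : A ∈ T) (hB : B ∈ T) {x : E d}
    (hxA : x ∈ A) (hxB : x ∈ interior B) : A = B := by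
  have h1 : A ∩ B = B := IsExposed.eq_of_inter_interior_nonempty (hT.face_to_face A hA B hB).2
    ⟨x, ⟨hxA, interior_subset hxB⟩, hxB⟩
  have h2 : A ∩ B = A := IsExposed.eq_of_inter_interior_nonempty (hT.face_to_face A hA B hB).1
    ⟨x, ⟨hxA, interior_subset hxB⟩, interior_mono (h1 ▸ Set.inter_subset_left) hxB⟩
  rw [← h2, h1]

lemma exists_mem (hT : IsParallelohedralTiling P T) (x : E d) : ∃ A ∈ T, x ∈ A := by
  have : x ∈ ⋃₀ T := hT.covers ▸ Set.mem_univ x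
  exact this

lemma mem_of_mem_openSegment (hT : IsParallelohedralTiling P T) (hA : A ∈ T) (hB : B ∈ T)
    {x y w : E d} (hx : x ∈ A) (hy : y ∈ A) (hw : w ∈ openSegment ℝ x y) (hwB : w ∈ B) : x ∈ B :=
  ((hT.face_to_face A hA B hB).1.isExtreme.left_mem_of_mem_openSegment hx hy
    ⟨(hT.convex hA).openSegment_subset hx hy hw, hwB⟩ hw).2

/-- The translation vectors of these tiles lie in a ball of radius `r + M`. Two of them in the same
small covering ball would place an interior point of one tile inside the other. -/
lemma finite_inter_closedBall (hT : IsParallelohedralTiling P T) (r : ℝ) :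
    {A ∈ T | (A ∩ Metric.closedBall 0 r).Nonempty}.Finite := by
  choose! v hv using hT.translates
  obtain ⟨p, hp⟩ := hT.polytope.2
  obtain ⟨ρ, hρ, hball⟩ := Metric.isOpen_iff.1 isOpen_interior p hp
  obtain ⟨M, hM⟩ := hT.polytope.isCompact.isBounded.exists_norm_le
  obtain ⟨t, -, ht, hcov⟩ := (isCompact_closedBall (0 : E d) (r + M)).finite_cover_balls
    (half_pos hρ)
  have hmem : ∀ A ∈ {A ∈ T | (A ∩ Metric.closedBall 0 r).Nonempty},
      ∃ c ∈ t, v A ∈ Metric.ball c (ρ / 2) := by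
    rintro A ⟨hA, x, hxA, hxr⟩
    rw [hv A hA] at hxA
    obtain ⟨y, hy, rfl⟩ := hxA
    have : v A ∈ Metric.closedBall (0 : E d) (r + M) := by
      rw [mem_closedBall_zero_iff] at hxr ⊢
      have h1 : v A = (v A +ᵥ y) - y := by simp
      rw [h1]
      exact (norm_sub_le _ _).trans (add_le_add hxr (hM y hy))
    simpa using hcov this
  choose! c hct hc using hmem
  refine Set.Finite.of_injOn (f := c) (fun A hA => hct A hA) ?_ ht
  intro A hA B hB hAB
  have h1 := hc A hA
  have h2 := hc B hB
  rw [hAB] at h1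
  have hd : dist (v A) (v B) < ρ := by
    have := dist_triangle_right (v A) (v B) (c B)
    rw [Metric.mem_ball] at h1 h2
    linarith
  refine hT.eq_of_mem_interior hA.1 hB.1 (x := v A +ᵥ p) ?_ ?_
  · have : v A +ᵥ p ∈ v A +ᵥ P := Set.vadd_mem_vadd_set (interior_subset hp)
    rwa [← hv A hA.1] at this
  · suffices h : v A +ᵥ p ∈ interior (v B +ᵥ P) by rwa [← hv B hB.1] at h
    rw [interior_vadd, Set.mem_vadd_set_iff_neg_vadd_mem]
    apply hball
    rw [Metric.mem_ball, dist_eq_norm] at *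
    convert hd using 2
    simp only [vadd_eq_add]
    abel

lemma finite_inter_nonempty (hT : IsParallelohedralTiling P T) {S : Set (E d)}
    (hS : Bornology.IsBounded S) : {A ∈ T | (A ∩ S).Nonempty}.Finite := by
  obtain ⟨r, hr⟩ := hS.subset_closedBall 0
  refine (hT.finite_inter_closedBall r).subset ?_
  rintro A ⟨hA, h⟩
  exact ⟨hA, h.mono (Set.inter_subset_inter_right _ hr)⟩

lemma finite_mem (hT : IsParallelohedralTiling P T) (x : E d) : {A ∈ T | x ∈ A}.Finite := by
  refine (hT.finite_inter_nonempty (S := {x}) Bornology.isBounded_singleton).subset ?_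
  rintro A ⟨hA, h⟩
  exact ⟨hA, x, h, rfl⟩

lemma countable (hT : IsParallelohedralTiling P T) : T.Countable := by
  refine Set.PairwiseDisjoint.countable_of_isOpen (s := interior) ?_
    (fun A _ => isOpen_interior) (fun A hA => hT.interior_nonempty hA)
  intro A hA B hB hAB
  refine Set.disjoint_left.2 fun x hxA hxB => hAB ?_
  exact hT.eq_of_mem_interior hA hB (interior_subset hxA) hxB

lemma locallyFinite (hT : IsParallelohedralTiling P T) :
    LocallyFinite (fun A : T => (A : Set (E d))) := by
  intro x
  refine ⟨Metric.ball x 1, Metric.ball_mem_nhds x one_pos, ?_⟩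
  have := hT.finite_inter_nonempty (Metric.isBounded_ball (x := x) (r := 1))
  refine Set.Finite.of_finite_image (this.subset ?_) Subtype.val_injective.injOn
  rintro _ ⟨A, hA, rfl⟩
  exact ⟨A.2, hA⟩

lemma isClosed_sUnion (hT : IsParallelohedralTiling P T) {S : Set (Set (E d))} (hS : S ⊆ T) :
    IsClosed (⋃₀ S) := by
  rw [Set.sUnion_eq_iUnion]
  exact (hT.locallyFinite.comp_injective (Set.inclusion_injective hS)).isClosed_iUnion
    fun A => hT.isClosed (hS A.2)

/-- All tiles that come close to `x` contain `x`. -/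
lemma exists_ball (hT : IsParallelohedralTiling P T) (x : E d) :
    ∃ ε > 0, ∀ A ∈ T, (A ∩ Metric.ball x ε).Nonempty → x ∈ A := by
  have hc : IsClosed (⋃₀ {A ∈ T | x ∉ A}) := hT.isClosed_sUnion fun A hA => hA.1
  have hx : x ∈ (⋃₀ {A ∈ T | x ∉ A})ᶜ := by
    rintro ⟨A, hA, hxA⟩
    exact hA.2 hxA
  obtain ⟨ε, hε, h⟩ := Metric.isOpen_iff.1 hc.isOpen_compl x hx
  refine ⟨ε, hε, fun A hA ⟨y, hyA, hy⟩ => ?_⟩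
  by_contra hxA
  exact h hy ⟨A, ⟨hA, hxA⟩, hyA⟩

/-- A property of tiles that spreads between tiles sharing a point of a connected set `S` is
common to all tiles that meet `S`. -/
lemma forall_of_isPreconnected (hT : IsParallelohedralTiling P T) {S : Set (E d)}
    (hS : IsPreconnected S) (p : Set (E d) → Prop)
    (hp : ∀ w ∈ S, ∀ A ∈ T, ∀ B ∈ T, w ∈ A → w ∈ B → p A → p B)
    (hA : A ∈ T) (hAS : (A ∩ S).Nonempty) (hpA : p A) (hB : B ∈ T) (hBS : (B ∩ S).Nonempty) :
    p B := by
  by_contra hpB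
  obtain ⟨w, hwS, ⟨C, hC, hwC⟩, D, hD, hwD⟩ := isPreconnected_closed_iff.1 hS
    (⋃₀ {A ∈ T | p A}) (⋃₀ {A ∈ T | ¬ p A}) (hT.isClosed_sUnion fun A hA => hA.1)
    (hT.isClosed_sUnion fun A hA => hA.1) (by
      intro w _
      obtain ⟨C, hC, hwC⟩ := hT.exists_mem w
      by_cases h : p C
      · exact Or.inl ⟨C, ⟨hC, h⟩, hwC⟩
      · exact Or.inr ⟨C, ⟨hC, h⟩, hwC⟩)
    (by
      obtain ⟨w, hw, hwS⟩ := hAS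
      exact ⟨w, hwS, A, ⟨hA, hpA⟩, hw⟩)
    (by
      obtain ⟨w, hw, hwS⟩ := hBS
      exact ⟨w, hwS, B, ⟨hB, hpB⟩, hw⟩)
  exact hD.2 (hp w hwS C hC.1 D hD.1 hwC hwD hC.2)

end IsParallelohedralTiling

/-! ### The minimal face at a point, and general position -/

/-- The intersection of all tiles containing `x`. -/
def minFace (T : Set (Set (E d))) (x : E d) : Set (E d) := ⋂₀ {A ∈ T | x ∈ A}

/-- The points at which the minimal face has codimension at most two. -/
def good (T : Set (Set (E d))) : Set (E d) := {x | d ≤ dim (minFace T x) + 2}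

lemma mem_minFace (x : E d) : x ∈ minFace T x := fun _ hA => hA.2

lemma minFace_subset {A : Set (E d)} {x : E d} (hA : A ∈ T) (hx : x ∈ A) : minFace T x ⊆ A :=
  Set.sInter_subset_of_mem ⟨hA, hx⟩

lemma dim_mono {F G : Set (E d)} (h : F ⊆ G) : dim F ≤ dim G :=
  Submodule.finrank_mono (vectorSpan_mono ℝ h)

lemma dim_insert_le (x : E d) (F : Set (E d)) : dim (insert x F) ≤ dim F + 1 := by
  have := finrank_vectorSpan_insert_le (k := ℝ) (affineSpan ℝ F) x
  rw [direction_affineSpan] at this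
  refine le_trans (Submodule.finrank_mono (vectorSpan_mono ℝ ?_)) this
  exact Set.insert_subset_insert (subset_affineSpan ℝ F)

/-- Proper affine subspaces are null sets, so countably many of them cannot cover a nonempty open
set. -/
lemma exists_mem_forall_notMem_affineSpan {𝒮 : Set (Set (E d))} (h𝒮 : 𝒮.Countable)
    (hdim : ∀ F ∈ 𝒮, dim F < d) {O : Set (E d)} (hO : IsOpen O) (hne : O.Nonempty) :
    ∃ y ∈ O, ∀ F ∈ 𝒮, y ∉ affineSpan ℝ F := by
  by_contra! hcon
  have h0 : MeasureTheory.volume (⋃ F ∈ 𝒮, (affineSpan ℝ F : Set (E d))) = 0 := by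
    rw [MeasureTheory.measure_biUnion_null_iff h𝒮]
    intro F hF
    refine MeasureTheory.Measure.addHaar_affineSubspace _ _ fun htop => ?_
    have h1 := hdim F hF
    have h2 : vectorSpan ℝ F = ⊤ := by
      rw [← direction_affineSpan, htop, AffineSubspace.direction_top]
    rw [dim, h2, finrank_top] at h1
    simp at h1
  have h1 : MeasureTheory.volume O = 0 := by
    refine MeasureTheory.measure_mono_null ?_ h0
    intro y hy
    obtain ⟨F, hF, hyF⟩ := hcon y hy
    exact Set.mem_biUnion hF hyF
  exact (hO.measure_pos MeasureTheory.volume hne).ne' h1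

namespace IsParallelohedralTiling

variable {A B C : Set (E d)}

lemma countable_range_minFace (hT : IsParallelohedralTiling P T) :
    (Set.range (minFace T)).Countable := by
  have h := (Set.countable_ofPred_finite_subset hT.countable).image Set.sInter
  refine h.mono ?_
  rintro _ ⟨x, rfl⟩
  exact ⟨_, ⟨hT.finite_mem x, fun A hA => hA.1⟩, rfl⟩

lemma isExposed_minFace (hT : IsParallelohedralTiling P T) {x : E d} (hA : A ∈ T) (hx : x ∈ A) :
    IsExposed ℝ A (minFace T x) := by
  have hfin := (hT.finite_mem x).image (A ∩ ·)
  have hne : hfin.toFinset.Nonempty := ⟨A ∩ A, hfin.mem_toFinset.2 ⟨A, ⟨hA, hx⟩, rfl⟩⟩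
  have := IsExposed.sInter (𝕜 := ℝ) (A := A) hne (by
    intro F hF
    simp only [Set.Finite.mem_toFinset, Set.mem_image] at hF
    obtain ⟨B, hB, rfl⟩ := hF
    exact (hT.face_to_face A hA B hB.1).1)
  suffices h : minFace T x = ⋂₀ hfin.toFinset by rwa [h]
  ext y
  simp only [minFace, Set.mem_sInter, Set.Finite.coe_toFinset, Set.mem_image]
  constructor
  · rintro h _ ⟨B, hB, rfl⟩
    exact ⟨h A ⟨hA, hx⟩, h B hB⟩
  · intro h B hB
    exact (h _ ⟨B, hB, rfl⟩).2

/-- The segments from `x` to almost all points only cross facets. -/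
lemma exists_segment (hT : IsParallelohedralTiling P T) (x : E d) {O : Set (E d)}
    (hO : IsOpen O) (hne : O.Nonempty) :
    ∃ y ∈ O, ∀ w ∈ segment ℝ x y, w ≠ x → d ≤ dim (minFace T w) + 1 := by
  obtain ⟨y, hy, h⟩ := exists_mem_forall_notMem_affineSpan
    (𝒮 := (insert x) '' {F ∈ Set.range (minFace T) | dim F + 1 < d})
    ((hT.countable_range_minFace.mono fun F hF => hF.1).image _) (by
      rintro _ ⟨F, ⟨-, hF⟩, rfl⟩
      exact (dim_insert_le x F).trans_lt hF) hO hne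
  refine ⟨y, hy, fun w hw hwx => ?_⟩
  by_contra! hlt
  refine h _ ⟨minFace T w, ⟨⟨w, rfl⟩, hlt⟩, rfl⟩ ?_
  rw [segment_eq_image_lineMap] at hw
  obtain ⟨t, -, rfl⟩ := hw
  set w := AffineMap.lineMap x y t with hw
  have ht : t ≠ 0 := by
    rintro rfl
    simp [hw] at hwx
  -- As `w ≠ x`, the point `y` is on the line through `x` and `w`, hence in the span that it was
  -- chosen to avoid.
  have h1 : w ∈ affineSpan ℝ (insert x (minFace T w)) :=
    subset_affineSpan ℝ _ (Set.mem_insert_of_mem _ (mem_minFace w))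
  have h2 : x ∈ affineSpan ℝ (insert x (minFace T w)) :=
    subset_affineSpan ℝ _ (Set.mem_insert _ _)
  have h3 := AffineMap.lineMap_mem t⁻¹ h2 h1
  convert h3 using 1
  rw [hw, AffineMap.lineMap_apply, AffineMap.lineMap_apply]
  simp [smul_smul, ht]

/-- If `[p, x]` meets no face of codimension three or more, then neither do the triangles with
this side and almost every third vertex. -/
lemma exists_triangle (hT : IsParallelohedralTiling P T) {p x x' : E d}
    (hx : segment ℝ p x ⊆ good T) (hx' : segment ℝ p x' ⊆ good T) {O : Set (E d)}
    (hO : IsOpen O) (hne : O.Nonempty) :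
    ∃ y ∈ O, convexHull ℝ {p, x, y} ⊆ good T ∧ convexHull ℝ {p, x', y} ⊆ good T := by
  obtain ⟨y, hy, h⟩ := exists_mem_forall_notMem_affineSpan
    (𝒮 := (fun F => insert p (insert x F)) '' {F ∈ Set.range (minFace T) | dim F + 2 < d} ∪
      (fun F => insert p (insert x' F)) '' {F ∈ Set.range (minFace T) | dim F + 2 < d})
    (((hT.countable_range_minFace.mono fun F hF => hF.1).image _).union
      ((hT.countable_range_minFace.mono fun F hF => hF.1).image _)) (by
      rintro _ (⟨F, ⟨-, hF⟩, rfl⟩ | ⟨F, ⟨-, hF⟩, rfl⟩)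
      · have := (dim_insert_le p (insert x F)).trans (Nat.add_le_add_right (dim_insert_le x F) 1)
        exact this.trans_lt hF
      · have := (dim_insert_le p (insert x' F)).trans (Nat.add_le_add_right (dim_insert_le x' F) 1)
        exact this.trans_lt hF) hO hne
  -- A point `w` of the triangle lies on `[y, q]` for some `q ∈ [p, z]`. If `w` is not good then `w
  -- ≠ q`, so `y` is on the line through `q` and `w`, inside the avoided span of `p`, `z` and the
  -- minimal face at `w`.
  have key : ∀ z, segment ℝ p z ⊆ good T →
      (∀ F ∈ Set.range (minFace T), dim F + 2 < d → y ∉ affineSpan ℝ (insert p (insert z F))) →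
      convexHull ℝ {p, z, y} ⊆ good T := by
    intro z hz hyz w hw
    by_contra hlt
    have hlt' : dim (minFace T w) + 2 < d := by simpa [good] using hlt
    refine hyz _ ⟨w, rfl⟩ hlt' ?_
    have hw' : w ∈ convexHull ℝ {y, p, z} := by
      convert hw using 2
      rw [Set.insert_comm, Set.pair_comm]
    rw [convexHull_insert (Set.insert_nonempty _ _), convexHull_pair, mem_convexJoin] at hw'
    obtain ⟨y', hy', q, hq, hwq⟩ := hw'
    rw [Set.mem_singleton_iff] at hy'
    subst hy'
    have hqs : q ∈ affineSpan ℝ (insert p (insert z (minFace T w))) := by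
      rw [segment_eq_image_lineMap] at hq
      obtain ⟨t, -, rfl⟩ := hq
      exact AffineMap.lineMap_mem t (subset_affineSpan ℝ _ (by simp))
        (subset_affineSpan ℝ _ (by simp))
    have hws : w ∈ affineSpan ℝ (insert p (insert z (minFace T w))) :=
      subset_affineSpan ℝ _ (by simp [mem_minFace])
    rw [segment_symm, segment_eq_image_lineMap] at hwq
    obtain ⟨t, -, ht⟩ := hwq
    have ht0 : t ≠ 0 := by
      rintro rfl
      rw [AffineMap.lineMap_apply_zero] at ht
      exact hlt (ht ▸ hz hq)
    have h3 := AffineMap.lineMap_mem t⁻¹ hqs hws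
    convert h3 using 1
    rw [← ht, AffineMap.lineMap_apply, AffineMap.lineMap_apply]
    simp [smul_smul, ht0]
  exact ⟨y, hy, key x hx fun F hF hd => h _ (Or.inl ⟨F, ⟨hF, hd⟩, rfl⟩),
    key x' hx' fun F hF hd => h _ (Or.inr ⟨F, ⟨hF, hd⟩, rfl⟩)⟩

end IsParallelohedralTiling

end Tiling

/-! ### Facets and their normals -/

lemma mem_vectorSpan_orthogonal_iff {F : Set (E d)} {n : E d} :
    n ∈ (vectorSpan ℝ F)ᗮ ↔ ∀ x ∈ F, ∀ y ∈ F, ⟪n, x⟫_ℝ = ⟪n, y⟫_ℝ := by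
  rw [Submodule.mem_orthogonal']
  constructor
  · intro h x hx y hy
    have := h _ (vsub_mem_vectorSpan ℝ hx hy)
    rw [vsub_eq_sub, inner_sub_right] at this
    linarith
  · intro h v hv
    have hle : vectorSpan ℝ F ≤ (Submodule.span ℝ {n})ᗮ := by
      rw [vectorSpan_def, Submodule.span_le]
      rintro _ ⟨x, hx, y, hy, rfl⟩
      simp only [vsub_eq_sub, SetLike.mem_coe, Submodule.mem_orthogonal_singleton_iff_inner_right,
        inner_sub_right]
      rw [h x hx y hy, sub_self]
    exact (Submodule.mem_orthogonal_singleton_iff_inner_right).1 (hle hv)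

lemma dim_add_one_le {F : Set (E d)} {n : E d} (hn : n ≠ 0) (h : n ∈ (vectorSpan ℝ F)ᗮ) :
    dim F + 1 ≤ d := by
  have h1 := Submodule.finrank_add_finrank_orthogonal (vectorSpan ℝ F)
  have h2 : 0 < Module.finrank ℝ (vectorSpan ℝ F)ᗮ :=
    Module.finrank_pos_iff_exists_ne_zero.2 ⟨⟨n, h⟩, by simpa using hn⟩
  rw [finrank_euclideanSpace_fin] at h1
  unfold dim
  omega

lemma vectorSpan_orthogonal_eq {F : Set (E d)} {n : E d} (hF : d ≤ dim F + 1) (hn : n ≠ 0)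
    (h : n ∈ (vectorSpan ℝ F)ᗮ) : (vectorSpan ℝ F)ᗮ = Submodule.span ℝ {n} := by
  symm
  apply Submodule.eq_of_le_of_finrank_le
  · rwa [Submodule.span_singleton_le_iff_mem]
  · have h1 := Submodule.finrank_add_finrank_orthogonal (vectorSpan ℝ F)
    rw [finrank_euclideanSpace_fin] at h1
    rw [finrank_span_singleton hn]
    unfold dim at hF
    omega

lemma mem_vectorSpan_of_inner_eq_zero {F : Set (E d)} {n h : E d} (hF : d ≤ dim F + 1)
    (hn : n ≠ 0) (hnF : n ∈ (vectorSpan ℝ F)ᗮ) (hh : ⟪n, h⟫_ℝ = 0) : h ∈ vectorSpan ℝ F := by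
  rw [← Submodule.orthogonal_orthogonal (vectorSpan ℝ F), vectorSpan_orthogonal_eq hF hn hnF]
  exact Submodule.mem_orthogonal_singleton_iff_inner_right.2 hh

lemma eq_or_eq_neg_of_mem_orthogonal {F : Set (E d)} {m n : E d} (hF : d ≤ dim F + 1)
    (hm : ‖m‖ = 1) (hn : ‖n‖ = 1) (hmF : m ∈ (vectorSpan ℝ F)ᗮ) (hnF : n ∈ (vectorSpan ℝ F)ᗮ) :
    m = n ∨ m = -n := by
  have hn0 : n ≠ 0 := by
    rintro rfl
    simp at hn
  rw [vectorSpan_orthogonal_eq hF hn0 hnF, Submodule.mem_span_singleton] at hmF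
  obtain ⟨k, rfl⟩ := hmF
  rw [norm_smul, hn, mul_one, Real.norm_eq_abs] at hm
  rcases eq_or_eq_neg_of_abs_eq hm with rfl | rfl <;> simp

lemma inner_lt_of_mem_interior {A : Set (E d)} {n x : E d} {β : ℝ} (hn : ‖n‖ = 1)
    (h : ∀ y ∈ A, ⟪n, y⟫_ℝ ≤ β) (hx : x ∈ interior A) : ⟪n, x⟫_ℝ < β := by
  obtain ⟨ε, hε, hb⟩ := Metric.isOpen_iff.1 isOpen_interior x hx
  have hy : x + (ε / 2) • n ∈ interior A := by
    apply hb
    rw [Metric.mem_ball, dist_eq_norm, add_sub_cancel_left, norm_smul, hn, Real.norm_eq_abs,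
      abs_of_pos (half_pos hε)]
    linarith
  have := h _ (interior_subset hy)
  rw [inner_add_right, inner_smul_right, real_inner_self_eq_norm_sq, hn] at this
  linarith

lemma exists_unit_of_isExposed {A F : Set (E d)} (h : IsExposed ℝ A F) (hne : F.Nonempty)
    (hFA : F ≠ A) : ∃ n : E d, ‖n‖ = 1 ∧ F = {x ∈ A | ∀ y ∈ A, ⟪n, y⟫_ℝ ≤ ⟪n, x⟫_ℝ} := by
  obtain ⟨l, hl⟩ := h hne
  set m := (InnerProductSpace.toDual ℝ (E d)).symm l with hm
  have hml : ∀ x, l x = ⟪m, x⟫_ℝ := fun x => by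
    rw [hm, InnerProductSpace.toDual_symm_apply]
  have hm0 : m ≠ 0 := by
    intro h0
    apply hFA
    rw [hl]
    ext x
    simp [hml, h0]
  have hpos : 0 < ‖m‖⁻¹ := inv_pos.2 (norm_pos_iff.2 hm0)
  refine ⟨‖m‖⁻¹ • m, ?_, ?_⟩
  · rw [norm_smul, norm_inv, norm_norm, inv_mul_cancel₀ (norm_ne_zero_iff.2 hm0)]
  · rw [hl]
    ext x
    simp only [Set.mem_ofPred_eq, hml, real_inner_smul_left, mul_le_mul_iff_right₀ hpos]

lemma mem_orthogonal_of_eq {A F : Set (E d)} {n : E d}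
    (h : F = {x ∈ A | ∀ y ∈ A, ⟪n, y⟫_ℝ ≤ ⟪n, x⟫_ℝ}) : n ∈ (vectorSpan ℝ F)ᗮ := by
  rw [mem_vectorSpan_orthogonal_iff]
  intro x hx y hy
  rw [h] at hx hy
  exact le_antisymm (hy.2 x hx.1) (hx.2 y hy.1)

lemma exists_add_smul_mem {F : Set (E d)} {w h : E d} (hw : w ∈ intrinsicInterior ℝ F)
    (hh : h ∈ vectorSpan ℝ F) : ∃ ε > 0, ∀ t : ℝ, |t| ≤ ε → w + t • h ∈ F := by
  obtain ⟨w', hw', rfl⟩ := hw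
  have hmem : ∀ t : ℝ, t • h +ᵥ (w' : E d) ∈ affineSpan ℝ F := fun t =>
    AffineSubspace.vadd_mem_of_mem_direction
      (by rw [direction_affineSpan]; exact Submodule.smul_mem _ _ hh) w'.2
  let φ : ℝ → affineSpan ℝ F := fun t => ⟨t • h +ᵥ (w' : E d), hmem t⟩
  have hφ : Continuous φ := by
    refine Continuous.subtype_mk ?_ _
    simp only [vadd_eq_add]
    fun_prop
  have h0 : φ 0 = w' := by
    ext1
    simp [φ]
  have hnh : φ ⁻¹' interior (Subtype.val ⁻¹' F) ∈ nhds (0 : ℝ) :=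
    hφ.continuousAt.preimage_mem_nhds (by rw [h0]; exact isOpen_interior.mem_nhds hw')
  obtain ⟨ε, hε, hb⟩ := Metric.mem_nhds_iff.1 hnh
  refine ⟨ε / 2, half_pos hε, fun t ht => ?_⟩
  have h1 : t ∈ φ ⁻¹' interior (Subtype.val ⁻¹' F) := by
    apply hb
    rw [Metric.mem_ball, Real.dist_eq, sub_zero]
    linarith
  have h2 := interior_subset h1
  have h3 : (φ t : E d) ∈ F := h2
  rwa [add_comm]

/-- A convex set with a facet `F` contains, near each relatively interior point of `F`, everything
on its own side of `F`. -/
lemma exists_add_smul_sub_mem {A F : Set (E d)} (hA : Convex ℝ A) (hFA : F ⊆ A) {n w a b : E d}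
    (hF : d ≤ dim F + 1) (hn : n ≠ 0) (hnF : n ∈ (vectorSpan ℝ F)ᗮ)
    (hw : w ∈ intrinsicInterior ℝ F) (ha : a ∈ A) (haw : ⟪n, a⟫_ℝ < ⟪n, w⟫_ℝ)
    (hbw : ⟪n, b⟫_ℝ < ⟪n, w⟫_ℝ) : ∃ ε : ℝ, 0 < ε ∧ ε < 1 ∧ w + ε • (b - w) ∈ A := by
  -- With this `τ` the vectors `b - w` and `τ • (a - w)` have the same component along `n`, so their
  -- difference is parallel to `F`.
  set τ := (⟪n, w⟫_ℝ - ⟪n, b⟫_ℝ) / (⟪n, w⟫_ℝ - ⟪n, a⟫_ℝ) with hτ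
  have hpos : 0 < ⟪n, w⟫_ℝ - ⟪n, a⟫_ℝ := sub_pos.2 haw
  have hτ0 : 0 < τ := div_pos (sub_pos.2 hbw) hpos
  have hh : ⟪n, (b - w) - τ • (a - w)⟫_ℝ = 0 := by
    rw [inner_sub_right, inner_smul_right, inner_sub_right, inner_sub_right, hτ]
    field_simp
    ring
  obtain ⟨ε, hε, hmem⟩ := exists_add_smul_mem hw (mem_vectorSpan_of_inner_eq_zero hF hn hnF hh)
  -- The target `w + δ • (b - w)` is the midpoint of a point of `F` (needs `2δ ≤ ε`) and a point of
  -- the segment from `w` to `a` (needs `2δτ ≤ 1`).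
  set δ := min (ε / 2) (min (1 / 2) (1 / (2 * τ))) with hδ
  have hδ0 : 0 < δ := by positivity
  have hδ1 : δ ≤ ε / 2 := min_le_left _ _
  have hδ2 : δ ≤ 1 / 2 := (min_le_right _ _).trans (min_le_left _ _)
  have hδ3 : δ ≤ 1 / (2 * τ) := (min_le_right _ _).trans (min_le_right _ _)
  rw [le_div_iff₀ (by positivity)] at hδ3
  refine ⟨δ, hδ0, by linarith, ?_⟩
  have h1 : w + (2 * δ) • ((b - w) - τ • (a - w)) ∈ A :=
    hFA (hmem _ (by rw [abs_of_pos (by positivity)]; linarith))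
  have h2 : (1 - 2 * δ * τ) • w + (2 * δ * τ) • a ∈ A :=
    hA (hFA (intrinsicInterior_subset hw)) ha (by linarith) (by positivity) (by ring)
  have h3 := hA h1 h2 (a := 1 / 2) (b := 1 / 2) (by norm_num) (by norm_num) (by norm_num)
  convert h3 using 1
  module

lemma IsUnitNormal.neg {A B : Set (E d)} {n : E d} (h : IsUnitNormal A B n) :
    IsUnitNormal B A (-n) := by
  refine ⟨by rw [norm_neg, h.1], ?_, fun b hb a ha => ?_⟩
  · rw [Set.inter_comm]
    exact neg_mem h.2.1
  · rw [inner_neg_left, inner_neg_left, neg_le_neg_iff]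
    exact h.2.2 a ha b hb

lemma IsUnitNormal.ne_zero {A B : Set (E d)} {n : E d} (h : IsUnitNormal A B n) : n ≠ 0 := by
  rintro rfl
  simpa using h.1

section Tiling

variable {P : Set (E d)} {T : Set (Set (E d))} {A B C : Set (E d)}

lemma Adjacent.symm (h : Adjacent T A B) : Adjacent T B A :=
  ⟨h.2.1, h.1, h.2.2.1.symm, Set.inter_comm A B ▸ h.2.2.2⟩

lemma Adjacent.nonempty (h : Adjacent T A B) : (A ∩ B).Nonempty := h.2.2.2.1.1

lemma Adjacent.dim_eq (h : Adjacent T A B) : dim (A ∩ B) + 1 = d := h.2.2.2.2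

namespace IsParallelohedralTiling

lemma inter_ne_left (hT : IsParallelohedralTiling P T) (hA : A ∈ T) (hB : B ∈ T) (hAB : A ≠ B) :
    A ∩ B ≠ A := by
  intro h
  obtain ⟨x, hx⟩ := hT.interior_nonempty hA
  exact hAB (hT.eq_of_mem_interior hB hA (Set.inter_eq_left.1 h (interior_subset hx)) hx).symm

lemma adjacent_of_le_dim (hT : IsParallelohedralTiling P T) (hA : A ∈ T) (hB : B ∈ T)
    (hAB : A ≠ B) (hne : (A ∩ B).Nonempty) (h : d ≤ dim (A ∩ B) + 1) : Adjacent T A B := by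
  refine ⟨hA, hB, hAB, ⟨hne, A, hA, (hT.face_to_face A hA B hB).1⟩, le_antisymm ?_ h⟩
  obtain ⟨n, hn, hF⟩ := exists_unit_of_isExposed (hT.face_to_face A hA B hB).1 hne
    (hT.inter_ne_left hA hB hAB)
  exact dim_add_one_le (by rintro rfl; simp at hn) (mem_orthogonal_of_eq hF)

/-- Two tiles that contain a common facet and lie on the same side of it coincide. -/
lemma eq_of_same_side (hT : IsParallelohedralTiling P T) (hA : A ∈ T) (hB : B ∈ T)
    {F : Set (E d)} (hFc : Convex ℝ F) (hFne : F.Nonempty) (hFA : F ⊆ A) (hFB : F ⊆ B)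
    (hF : d ≤ dim F + 1) {n : E d} (hn : ‖n‖ = 1) (hnF : n ∈ (vectorSpan ℝ F)ᗮ)
    (h : ∀ w ∈ F, ∀ x ∈ A ∪ B, ⟪n, x⟫_ℝ ≤ ⟪n, w⟫_ℝ) : A = B := by
  obtain ⟨w, hw⟩ := hFne.intrinsicInterior hFc
  have hwF := intrinsicInterior_subset hw
  obtain ⟨a, ha⟩ := hT.interior_nonempty hA
  obtain ⟨b, hb⟩ := hT.interior_nonempty hB
  have ha' : ⟪n, a⟫_ℝ < ⟪n, w⟫_ℝ :=
    inner_lt_of_mem_interior hn (fun y hy => h w hwF y (Or.inl hy)) ha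
  have hb' : ⟪n, b⟫_ℝ < ⟪n, w⟫_ℝ :=
    inner_lt_of_mem_interior hn (fun y hy => h w hwF y (Or.inr hy)) hb
  obtain ⟨ε, hε0, hε1, hmem⟩ := exists_add_smul_sub_mem (hT.convex hA) hFA hF
    (by rintro rfl; simp at hn) hnF hw (interior_subset ha) ha' hb'
  refine hT.eq_of_mem_interior hA hB hmem ?_
  have := (hT.convex hB).combo_interior_self_mem_interior hb (hFB hwF) hε0
    (sub_nonneg.2 hε1.le) (by ring)
  convert this using 1
  module

lemma not_const (hT : IsParallelohedralTiling P T) (hA : A ∈ T) {n : E d} (hn : ‖n‖ = 1) {β : ℝ}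
    (h1 : ∀ x ∈ A, ⟪n, x⟫_ℝ ≤ β) (h2 : ∀ x ∈ A, β ≤ ⟪n, x⟫_ℝ) : False := by
  obtain ⟨a, ha⟩ := hT.interior_nonempty hA
  have := inner_lt_of_mem_interior hn h1 ha
  exact this.not_ge (h2 a (interior_subset ha))

lemma convex_inter (hT : IsParallelohedralTiling P T) (hA : A ∈ T) (hB : B ∈ T) :
    Convex ℝ (A ∩ B) := (hT.convex hA).inter (hT.convex hB)

/-- The unit vectors exposing `A ∩ B` in `A` and in `B` agree up to sign. Equal signs would put both
tiles on one side of the facet, so they are opposite. -/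
lemma exists_isUnitNormal_eq (hT : IsParallelohedralTiling P T) (h : Adjacent T A B) :
    ∃ n, IsUnitNormal A B n ∧ A ∩ B = {x ∈ A | ∀ y ∈ A, ⟪n, y⟫_ℝ ≤ ⟪n, x⟫_ℝ} := by
  have hA := h.1
  have hB := h.2.1
  obtain ⟨n, hn, hF⟩ := exists_unit_of_isExposed (hT.face_to_face A hA B hB).1 h.nonempty
    (hT.inter_ne_left hA hB h.2.2.1)
  obtain ⟨m, hm, hF'⟩ := exists_unit_of_isExposed (hT.face_to_face A hA B hB).2 h.nonempty
    (by rw [Set.inter_comm]; exact hT.inter_ne_left hB hA h.2.2.1.symm)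
  have hnF := mem_orthogonal_of_eq hF
  have hmF := mem_orthogonal_of_eq hF'
  have hd := h.dim_eq.ge
  have hneg : m = -n := by
    rcases eq_or_eq_neg_of_mem_orthogonal hd hm hn hmF hnF with rfl | rfl
    · refine absurd (hT.eq_of_same_side hA hB (hT.convex_inter hA hB) h.nonempty
        Set.inter_subset_left Set.inter_subset_right hd hn hnF ?_) h.2.2.1
      rintro w hw x (hx | hx)
      · rw [hF] at hw
        exact hw.2 x hx
      · rw [hF'] at hw
        exact hw.2 x hx
    · rfl
  refine ⟨n, ⟨hn, hnF, fun a ha b hb => ?_⟩, hF⟩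
  obtain ⟨w, hw⟩ := h.nonempty
  have h1 : ⟪n, a⟫_ℝ ≤ ⟪n, w⟫_ℝ := by
    rw [hF] at hw
    exact hw.2 a ha
  have h2 : ⟪m, b⟫_ℝ ≤ ⟪m, w⟫_ℝ := by
    rw [hF'] at hw
    exact hw.2 b hb
  rw [hneg, inner_neg_left, inner_neg_left, neg_le_neg_iff] at h2
  exact h1.trans h2

lemma isUnitNormal_unique (hT : IsParallelohedralTiling P T) (h : Adjacent T A B) {m n : E d}
    (hm : IsUnitNormal A B m) (hn : IsUnitNormal A B n) : m = n := by
  rcases eq_or_eq_neg_of_mem_orthogonal h.dim_eq.ge hm.1 hn.1 hm.2.1 hn.2.1 with rfl | rfl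
  · rfl
  · obtain ⟨w, hwA, hwB⟩ := h.nonempty
    refine (hT.not_const h.1 hn.1 (β := ⟪n, w⟫_ℝ) (fun x hx => hn.2.2 x hx w hwB) ?_).elim
    intro x hx
    have := hm.2.2 x hx w hwB
    rwa [inner_neg_left, inner_neg_left, neg_le_neg_iff] at this

lemma inter_eq_of_isUnitNormal (hT : IsParallelohedralTiling P T) (h : Adjacent T A B) {n : E d}
    (hn : IsUnitNormal A B n) : A ∩ B = {x ∈ A | ∀ y ∈ A, ⟪n, y⟫_ℝ ≤ ⟪n, x⟫_ℝ} := by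
  obtain ⟨m, hm, hF⟩ := hT.exists_isUnitNormal_eq h
  rwa [hT.isUnitNormal_unique h hm hn] at hF

lemma mem_of_inner_eq (hT : IsParallelohedralTiling P T) (h : Adjacent T A B) {n w x : E d}
    (hn : IsUnitNormal A B n) (hw : w ∈ A ∩ B) (hx : x ∈ A) (hxw : ⟪n, x⟫_ℝ = ⟪n, w⟫_ℝ) :
    x ∈ B := by
  have : x ∈ A ∩ B := by
    rw [hT.inter_eq_of_isUnitNormal h hn]
    exact ⟨hx, fun y hy => hxw ▸ hn.2.2 y hy w hw.2⟩
  exact this.2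

/-- A facet belongs to at most two tiles. -/
lemma eq_or_eq_of_subset (hT : IsParallelohedralTiling P T) (h : Adjacent T A B) (hC : C ∈ T)
    {F : Set (E d)} (hne : F.Nonempty) (hF : d ≤ dim F + 1) (hFA : F ⊆ A) (hFB : F ⊆ B)
    (hFC : F ⊆ C) : C = A ∨ C = B := by
  by_contra! hcon
  have hA := h.1
  have hB := h.2.1
  set G := A ∩ B ∩ C with hG
  have hGAC : G ⊆ A ∩ C := fun x hx => ⟨hx.1.1, hx.2⟩
  have hFG : F ⊆ G := fun x hx => ⟨⟨hFA hx, hFB hx⟩, hFC hx⟩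
  have hGne := hne.mono hFG
  have hGd : d ≤ dim G + 1 := hF.trans (Nat.add_le_add_right (dim_mono hFG) 1)
  have hAC := hT.adjacent_of_le_dim hA hC hcon.1.symm (hGne.mono hGAC)
    (hGd.trans (Nat.add_le_add_right (dim_mono hGAC) 1))
  obtain ⟨n, hn, -⟩ := hT.exists_isUnitNormal_eq h
  obtain ⟨m, hm, -⟩ := hT.exists_isUnitNormal_eq hAC
  have hnG : n ∈ (vectorSpan ℝ G)ᗮ :=
    Submodule.orthogonal_le (vectorSpan_mono ℝ Set.inter_subset_left) hn.2.1
  have hmG : m ∈ (vectorSpan ℝ G)ᗮ :=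
    Submodule.orthogonal_le (vectorSpan_mono ℝ hGAC) hm.2.1
  rcases eq_or_eq_neg_of_mem_orthogonal hGd hm.1 hn.1 hmG hnG with rfl | rfl
  · refine hcon.2 (hT.eq_of_same_side hB hC ((hT.convex_inter hA hB).inter (hT.convex hC)) hGne
      (fun x hx => hx.1.2) (fun x hx => hx.2) hGd hn.neg.1 (neg_mem hnG) ?_).symm
    rintro w hw x (hx | hx)
    · exact hn.neg.2.2 x hx w hw.1.1
    · exact hm.neg.2.2 x hx w hw.1.1
  · obtain ⟨w, hw⟩ := hGne
    refine hT.not_const hA hn.1 (β := ⟪n, w⟫_ℝ) (fun x hx => hn.2.2 x hx w hw.1.2) ?_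
    intro x hx
    have := hm.2.2 x hx w hw.2
    rwa [inner_neg_left, inner_neg_left, neg_le_neg_iff] at this

lemma subset_of_mem_intrinsicInterior (hT : IsParallelohedralTiling P T) (hA : A ∈ T)
    (hC : C ∈ T) {F : Set (E d)} (hFA : F ⊆ A) {w : E d} (hw : w ∈ intrinsicInterior ℝ F)
    (hwC : w ∈ C) : F ⊆ C := by
  intro y hy
  have hwF := intrinsicInterior_subset hw
  obtain ⟨ε, hε, h⟩ := exists_add_smul_mem hw (vsub_mem_vectorSpan ℝ hwF hy)
  have h1 := h ε (by rw [abs_of_pos hε])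
  -- `w` lies strictly between `y` and the prolongation `w + ε • (w - y)`, which is still in `F`.
  refine hT.mem_of_mem_openSegment hA hC (hFA hy) (hFA h1) (w := w) ?_ hwC
  refine ⟨ε / (1 + ε), 1 / (1 + ε), by positivity, by positivity, by field_simp; ring, ?_⟩
  simp only [vsub_eq_sub]
  have : w = ((1 + ε) / (1 + ε)) • w := by
    rw [div_self (by positivity), one_smul]
  nth_rw 3 [this]
  module

lemma exists_ball_subset_union (hT : IsParallelohedralTiling P T) (h : Adjacent T A B) :
    ∃ w ∈ A ∩ B, ∃ ε > 0, Metric.ball w ε ⊆ A ∪ B := by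
  obtain ⟨w, hw⟩ := h.nonempty.intrinsicInterior (hT.convex_inter h.1 h.2.1)
  refine ⟨w, intrinsicInterior_subset hw, ?_⟩
  obtain ⟨ε, hε, hb⟩ := hT.exists_ball w
  refine ⟨ε, hε, fun y hy => ?_⟩
  obtain ⟨C, hC, hyC⟩ := hT.exists_mem y
  have hwC := hb C hC ⟨y, hyC, hy⟩
  have hsub := hT.subset_of_mem_intrinsicInterior h.1 hC Set.inter_subset_left hw hwC
  rcases hT.eq_or_eq_of_subset h hC h.nonempty h.dim_eq.ge Set.inter_subset_left
    Set.inter_subset_right hsub with rfl | rfl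
  · exact Or.inl hyC
  · exact Or.inr hyC

lemma dim_eq (hT : IsParallelohedralTiling P T) (hA : A ∈ T) : dim A = d := by
  have h : affineSpan ℝ A = ⊤ :=
    ((hT.convex hA).interior_nonempty_iff_affineSpan_eq_top).1 (hT.interior_nonempty hA)
  have h2 : vectorSpan ℝ A = ⊤ := by
    rw [← direction_affineSpan, h, AffineSubspace.direction_top]
  rw [dim, h2, finrank_top, finrank_euclideanSpace_fin]

/-- Every facet of a tile is shared with another tile. -/
lemma exists_adjacent (hT : IsParallelohedralTiling P T) (hA : A ∈ T) {F : Set (E d)}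
    (hF : IsExposed ℝ A F) (hne : F.Nonempty) (hd : dim F + 1 = d) :
    ∃ B, Adjacent T A B ∧ A ∩ B = F := by
  have hFA : F ≠ A := by
    rintro rfl
    rw [hT.dim_eq hA] at hd
    omega
  obtain ⟨n, hn, hFn⟩ := exists_unit_of_isExposed hF hne hFA
  obtain ⟨w, hw⟩ := hne.intrinsicInterior (hF.convex (hT.convex hA))
  have hwF := intrinsicInterior_subset hw
  obtain ⟨ε, hε, hb⟩ := hT.exists_ball w
  -- The neighbour is found by stepping slightly out of `A` from a relatively interior point of the
  -- facet.
  obtain ⟨B, hB, hyB⟩ := hT.exists_mem (w + (ε / 2) • n)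
  have hwB : w ∈ B := by
    refine hb B hB ⟨_, hyB, ?_⟩
    rw [Metric.mem_ball, dist_eq_norm, add_sub_cancel_left, norm_smul, hn, Real.norm_eq_abs,
      abs_of_pos (half_pos hε)]
    linarith
  have hmax : ∀ w ∈ F, ∀ y ∈ A, ⟪n, y⟫_ℝ ≤ ⟪n, w⟫_ℝ := fun w hw => by
    rw [hFn] at hw
    exact hw.2
  have hAB : A ≠ B := by
    rintro rfl
    have := hmax w hwF _ hyB
    rw [inner_add_right, inner_smul_right, real_inner_self_eq_norm_sq, hn] at this
    linarith
  have hsub : F ⊆ A ∩ B := Set.subset_inter hF.subset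
    (hT.subset_of_mem_intrinsicInterior hA hB hF.subset hw hwB)
  have hadj := hT.adjacent_of_le_dim hA hB hAB (hne.mono hsub)
    (hd.ge.trans (Nat.add_le_add_right (dim_mono hsub) 1))
  refine ⟨B, hadj, ?_⟩
  obtain ⟨m, hm, hAm⟩ := hT.exists_isUnitNormal_eq hadj
  rcases eq_or_eq_neg_of_mem_orthogonal hd.ge hm.1 hn
    (Submodule.orthogonal_le (vectorSpan_mono ℝ hsub) hm.2.1) (mem_orthogonal_of_eq hFn)
    with rfl | rfl
  · rw [hAm, hFn]
  · refine (hT.not_const hA hn (hmax w hwF) fun x hx => ?_).elim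
    have := hm.2.2 x hx w hwB
    rwa [inner_neg_left, inner_neg_left, neg_le_neg_iff] at this

/-- Any two tiles that meet a convex open set `O` are joined by a chain of tiles in which
neighbours share a facet that meets `O`. -/
lemma forall_of_adjacent (hT : IsParallelohedralTiling P T) {O : Set (E d)} (hO : IsOpen O)
    (hOc : Convex ℝ O) (p : Set (E d) → Prop)
    (hp : ∀ A B, Adjacent T A B → (A ∩ B ∩ O).Nonempty → p A → p B)
    (hA : A ∈ T) (hAO : (A ∩ O).Nonempty) (hpA : p A) (hB : B ∈ T) (hBO : (B ∩ O).Nonempty) :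
    p B := by
  obtain ⟨x, hxA, hxO⟩ := hT.inter_interior_nonempty hA hO hAO
  obtain ⟨y, ⟨hyB, hyO⟩, hy⟩ := hT.exists_segment x (isOpen_interior.inter hO)
    (hT.inter_interior_nonempty hB hO hBO)
  refine hT.forall_of_isPreconnected (convex_segment x y).isPreconnected p ?_ hA
    ⟨x, interior_subset hxA, left_mem_segment ℝ x y⟩ hpA hB
    ⟨y, interior_subset hyB, right_mem_segment ℝ x y⟩
  intro w hw C hC D hD hwC hwD hpC
  by_cases hCD : C = D
  · exact hCD ▸ hpC
  have hwx : w ≠ x := by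
    rintro rfl
    exact hCD ((hT.eq_of_mem_interior hC hA hwC hxA).trans
      (hT.eq_of_mem_interior hD hA hwD hxA).symm)
  refine hp C D (hT.adjacent_of_le_dim hC hD hCD ⟨w, hwC, hwD⟩ ?_)
    ⟨w, ⟨hwC, hwD⟩, hOc.segment_subset hxO hyO hw⟩ hpC
  refine (hy w hw hwx).trans (Nat.add_le_add_right (dim_mono ?_) 1)
  exact Set.subset_inter (minFace_subset hC hwC) (minFace_subset hD hwD)

lemma forall_of_adjacent_at (hT : IsParallelohedralTiling P T) (x : E d) (p : Set (E d) → Prop)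
    (hp : ∀ A B, Adjacent T A B → x ∈ A → x ∈ B → p A → p B)
    (hA : A ∈ T) (hxA : x ∈ A) (hpA : p A) (hB : B ∈ T) (hxB : x ∈ B) : p B := by
  obtain ⟨ε, hε, hb⟩ := hT.exists_ball x
  refine hT.forall_of_adjacent Metric.isOpen_ball (convex_ball x ε) p ?_ hA
    ⟨x, hxA, Metric.mem_ball_self hε⟩ hpA hB ⟨x, hxB, Metric.mem_ball_self hε⟩
  rintro C D hCD ⟨y, ⟨hyC, hyD⟩, hy⟩
  exact hp C D hCD (hb C hCD.1 ⟨y, hyC, hy⟩) (hb D hCD.2.1 ⟨y, hyD, hy⟩)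

lemma forall_of_adjacent_univ (hT : IsParallelohedralTiling P T) (p : Set (E d) → Prop)
    (hp : ∀ A B, Adjacent T A B → p A → p B) (hA : A ∈ T) (hpA : p A) (hB : B ∈ T) : p B :=
  hT.forall_of_adjacent isOpen_univ convex_univ p (fun A B h _ => hp A B h) hA
    (by simpa using hT.nonempty hA) hpA hB (by simpa using hT.nonempty hB)

end IsParallelohedralTiling

end Tiling

/-! ### Jumps across facets and local potentials -/

/-- A unit normal to the common facet of `A` and `B`, directed from `A` to `B`. -/
def unitNormal (A B : Set (E d)) : E d := Classical.epsilon (IsUnitNormal A B)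

/-- The affine function, given by its gradient and its value at the origin, by which the lift of
`B` differs from the lift of an adjacent tile `A`. -/
def jump (s : Set (E d) → ℝ) (A B : Set (E d)) : E d × ℝ :=
  (s (A ∩ B) • unitNormal A B,
    -(s (A ∩ B) * ⟪unitNormal A B, Classical.epsilon (· ∈ A ∩ B)⟫_ℝ))

/-- `f` assigns to the tiles at `x` affine functions with the prescribed jumps. -/
def IsPotentialAt (T : Set (Set (E d))) (s : Set (E d) → ℝ) (x : E d)
    (f : Set (E d) → E d × ℝ) : Prop :=
  ∀ A B, Adjacent T A B → x ∈ A → x ∈ B → f B - f A = jump s A B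

/-- On a connected directed graph with in- and out-degrees at most one, prescribed differences along
the edges with sum zero are those of a function on the vertices. -/
lemma exists_potential_of_sum_eq_zero {α β V : Type*} [Fintype α] [Fintype β] [AddCommGroup V]
    [Module ℝ V] [FiniteDimensional ℝ V] (src tgt : β → α) (hs : Function.Injective src)
    (ht : Function.Injective tgt) (a : α)
    (hconn : ∀ φ : α → V, (∀ e, φ (tgt e) = φ (src e)) → ∀ b, φ b = φ a)
    (w : β → V) (hw : ∑ e, w e = 0) : ∃ f : α → V, ∀ e, f (tgt e) - f (src e) = w e := by
  classical
  let δ : (α → V) →ₗ[ℝ] (β → V) := LinearMap.funLeft ℝ V tgt - LinearMap.funLeft ℝ V src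
  have hδ : ∀ f e, δ f e = f (tgt e) - f (src e) := fun f e => rfl
  suffices h : w ∈ LinearMap.range δ by
    obtain ⟨f, rfl⟩ := h
    exact ⟨f, fun e => (hδ f e).symm⟩
  set m := Module.finrank ℝ V
  -- By connectedness a function in the kernel is constant, so its value at `a` determines it.
  have hker : Module.finrank ℝ (LinearMap.ker δ) ≤ m := by
    refine LinearMap.finrank_le_finrank_of_injective
      (f := (LinearMap.proj a : (α → V) →ₗ[ℝ] V) ∘ₗ (LinearMap.ker δ).subtype) ?_
    rw [← LinearMap.ker_eq_bot, LinearMap.ker_eq_bot']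
    rintro ⟨φ, hφ⟩ h0
    have h1 : ∀ e, φ (tgt e) = φ (src e) := fun e => by
      have := congrFun (LinearMap.mem_ker.1 hφ) e
      rw [hδ] at this
      exact sub_eq_zero.1 this
    ext b
    have h2 : φ a = 0 := h0
    simpa [h2] using hconn φ h1 b
  have hrank := δ.finrank_range_add_finrank_ker
  have hα : Module.finrank ℝ (α → V) = Fintype.card α * m := by
    rw [Module.finrank_pi_fintype]
    simp [m]
  have hβ : Module.finrank ℝ (β → V) = Fintype.card β * m := by
    rw [Module.finrank_pi_fintype]
    simp [m]
  -- With fewer edges than vertices the rank count alone makes `δ` surjective. With equally many,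
  -- `src` and `tgt` are bijections, the range of `δ` lies in the functions with sum zero, and
  -- dimensions agree.
  rcases (Fintype.card_le_of_injective src hs).lt_or_eq with hlt | heq
  · have : LinearMap.range δ = ⊤ := by
      apply Submodule.eq_top_of_finrank_eq
      refine le_antisymm (Submodule.finrank_le _) ?_
      rw [hβ]
      have : (Fintype.card β + 1) * m ≤ Fintype.card α * m := Nat.mul_le_mul_right _ hlt
      rw [add_mul, one_mul] at this
      omega
    rw [this]
    trivial
  · have hsb : Function.Bijective src :=
      (Fintype.bijective_iff_injective_and_card src).2 ⟨hs, heq⟩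
    have htb : Function.Bijective tgt :=
      (Fintype.bijective_iff_injective_and_card tgt).2 ⟨ht, heq⟩
    let σ : (β → V) →ₗ[ℝ] V := ∑ e, LinearMap.proj e
    have hσ : ∀ g, σ g = ∑ e, g e := fun g => by simp [σ]
    have hle : LinearMap.range δ ≤ LinearMap.ker σ := by
      rintro _ ⟨f, rfl⟩
      rw [LinearMap.mem_ker, hσ]
      simp only [hδ, Finset.sum_sub_distrib]
      rw [htb.sum_comp f, hsb.sum_comp f, sub_self]
    have hrange : LinearMap.range σ = ⊤ := by
      rw [LinearMap.range_eq_top]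
      intro v
      obtain ⟨e, -⟩ := hsb.2 a
      exact ⟨Pi.single e v, by rw [hσ, Finset.sum_pi_single']; simp⟩
    have hrank' := σ.finrank_range_add_finrank_ker
    rw [hrange, finrank_top] at hrank'
    have : LinearMap.range δ = LinearMap.ker σ := by
      apply Submodule.eq_of_le_of_finrank_le hle
      have : Fintype.card β * m = Fintype.card α * m := by rw [heq]
      omega
    rw [this, LinearMap.mem_ker, hσ, hw]

lemma exists_eq_smul_of_inner_eq_zero {N : Type*} [NormedAddCommGroup N] [InnerProductSpace ℝ N]
    (hN : Module.finrank ℝ N = 2) {n a b : N} (hn : n ≠ 0) (ha0 : a ≠ 0) (ha : ⟪n, a⟫_ℝ = 0)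
    (hb : ⟪n, b⟫_ℝ = 0) : ∃ β : ℝ, b = β • a := by
  have : Fact (Module.finrank ℝ N = 1 + 1) := ⟨hN⟩
  have h1 := Submodule.finrank_orthogonal_span_singleton (𝕜 := ℝ) (n := 1) hn
  let a' : (Submodule.span ℝ {n})ᗮ := ⟨a, Submodule.mem_orthogonal_singleton_iff_inner_right.2 ha⟩
  let b' : (Submodule.span ℝ {n})ᗮ := ⟨b, Submodule.mem_orthogonal_singleton_iff_inner_right.2 hb⟩
  obtain ⟨β, hβ⟩ := (finrank_eq_one_iff_of_nonzero' a' (by simpa [a'] using ha0)).1 h1 b'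
  exact ⟨β, (congrArg Subtype.val hβ).symm⟩

lemma eq_or_eq_neg_of_inner_eq_zero {N : Type*} [NormedAddCommGroup N] [InnerProductSpace ℝ N]
    (hN : Module.finrank ℝ N = 2) {n a b : N} (hn : n ≠ 0) (ha1 : ‖a‖ = 1) (hb1 : ‖b‖ = 1)
    (ha : ⟪n, a⟫_ℝ = 0) (hb : ⟪n, b⟫_ℝ = 0) : b = a ∨ b = -a := by
  obtain ⟨k, rfl⟩ := exists_eq_smul_of_inner_eq_zero hN hn (by rintro rfl; simp at ha1) ha hb
  rw [norm_smul, ha1, mul_one, Real.norm_eq_abs] at hb1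
  rcases eq_or_eq_neg_of_abs_eq hb1 with rfl | rfl <;> simp

lemma exists_quarterTurn {N : Type*} [NormedAddCommGroup N] [InnerProductSpace ℝ N]
    (hN : Module.finrank ℝ N = 2) : ∃ J : N →ₗᵢ[ℝ] N, ∀ w, ⟪J w, w⟫_ℝ = 0 := by
  have : Fact (Module.finrank ℝ N = 2) := ⟨hN⟩
  have : FiniteDimensional ℝ N := Module.finite_of_finrank_pos (by omega)
  let o : Orientation ℝ N (Fin 2) :=
    ((stdOrthonormalBasis ℝ N).toBasis.reindex (finCongr hN)).orientation
  exact ⟨o.rightAngleRotation.toLinearIsometry, fun w => o.inner_rightAngleRotation_self w⟩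

section Tiling

variable {P : Set (E d)} {T : Set (Set (E d))} {A B C : Set (E d)} {s : Set (E d) → ℝ}

namespace IsParallelohedralTiling

lemma jump_eq (hT : IsParallelohedralTiling P T) (h : Adjacent T A B) {n w : E d}
    (hn : IsUnitNormal A B n) (hw : w ∈ A ∩ B) :
    jump s A B = (s (A ∩ B) • n, -(s (A ∩ B) * ⟪n, w⟫_ℝ)) := by
  have h1 : unitNormal A B = n :=
    hT.isUnitNormal_unique h (Classical.epsilon_spec ⟨n, hn⟩) hn
  have h2 : Classical.epsilon (· ∈ A ∩ B) ∈ A ∩ B :=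
    Classical.epsilon_spec (p := (· ∈ A ∩ B)) ⟨w, hw⟩
  rw [jump, h1, mem_vectorSpan_orthogonal_iff.1 hn.2.1 _ h2 w hw]

lemma jump_symm (hT : IsParallelohedralTiling P T) (h : Adjacent T A B) :
    jump s B A = -jump s A B := by
  obtain ⟨n, hn, -⟩ := hT.exists_isUnitNormal_eq h
  obtain ⟨w, hw⟩ := h.nonempty
  rw [hT.jump_eq h hn hw, hT.jump_eq h.symm hn.neg ⟨hw.2, hw.1⟩, Set.inter_comm B A]
  simp

lemma isPotentialAt_unique (hT : IsParallelohedralTiling P T) {x : E d}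
    {f f' : Set (E d) → E d × ℝ} (hf : IsPotentialAt T s x f) (hf' : IsPotentialAt T s x f')
    (hA : A ∈ T) (hxA : x ∈ A) (hB : B ∈ T) (hxB : x ∈ B) : f B - f' B = f A - f' A := by
  refine hT.forall_of_adjacent_at x (fun C => f C - f' C = f A - f' A) ?_ hA hxA rfl hB hxB
  intro C D hCD hxC hxD h
  have h1 := hf C D hCD hxC hxD
  have h2 := hf' C D hCD hxC hxD
  rw [← h2] at h1
  rw [← h, sub_eq_sub_iff_add_eq_add] at *
  rw [add_comm, ← sub_eq_zero] at *
  rw [← h1]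
  abel

/-- At most two tiles contain `x`, so up to sign there is at most one jump to match. -/
lemma exists_isPotentialAt_of_facet (hT : IsParallelohedralTiling P T) {x : E d}
    (hx : d ≤ dim (minFace T x) + 1) : ∃ f, IsPotentialAt T s x f := by
  classical
  obtain ⟨A₀, hA₀, hxA₀⟩ := hT.exists_mem x
  refine ⟨fun B => if B = A₀ then 0 else jump s A₀ B, fun A B hAB hxA hxB => ?_⟩
  rcases hT.eq_or_eq_of_subset hAB hA₀ ⟨x, mem_minFace x⟩ hx (minFace_subset hAB.1 hxA)
    (minFace_subset hAB.2.1 hxB) (minFace_subset hA₀ hxA₀) with rfl | rfl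
  · simp [hAB.2.2.1.symm]
  · simp [hAB.2.2.1, hT.jump_symm hAB]

/-! ### Potentials around a ridge -/

section Ridge

variable {x : E d}

lemma finrank_normalSpace (hx : dim (minFace T x) + 2 = d) :
    Module.finrank ℝ (normalSpace (minFace T x)) = 2 := by
  have h1 := Submodule.finrank_add_finrank_orthogonal (vectorSpan ℝ (minFace T x))
  rw [finrank_euclideanSpace_fin] at h1
  unfold dim at hx
  unfold normalSpace
  omega

lemma vectorSpan_minFace_le (h : Adjacent T A B) (hxA : x ∈ A) (hxB : x ∈ B) :
    vectorSpan ℝ (minFace T x) ≤ vectorSpan ℝ (A ∩ B) :=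
  vectorSpan_mono ℝ (Set.subset_inter (minFace_subset h.1 hxA) (minFace_subset h.2.1 hxB))

/-- In the normal plane of the ridge the direction must be `± J n`. A vector `m` exposing the ridge
in `A` decides the sign: on `A ∩ B` the function `⟪n, ·⟫` is constant, so `⟪m, ·⟫` varies only
through its component `β` along `J n`. If `β = 0`, the whole facet would lie in the ridge. -/
lemma exists_isRayDirection (hT : IsParallelohedralTiling P T) (hx : dim (minFace T x) + 2 = d)
    (h : Adjacent T A B) (hxA : x ∈ A) (hxB : x ∈ B) :
    ∃ u, IsRayDirection (minFace T x) (A ∩ B) u := by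
  have hN := finrank_normalSpace hx
  obtain ⟨J, hJ⟩ := exists_quarterTurn hN
  obtain ⟨n, hn, -⟩ := hT.exists_isUnitNormal_eq h
  have hne : (minFace T x).Nonempty := ⟨x, mem_minFace x⟩
  obtain ⟨m, hm, hR⟩ := exists_unit_of_isExposed (hT.isExposed_minFace h.1 hxA) hne (by
    intro heq
    rw [heq, hT.dim_eq h.1] at hx
    omega)
  let n' : normalSpace (minFace T x) :=
    ⟨n, Submodule.orthogonal_le (vectorSpan_minFace_le h hxA hxB) hn.2.1⟩
  let m' : normalSpace (minFace T x) := ⟨m, mem_orthogonal_of_eq hR⟩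
  have hn1 : ‖n'‖ = 1 := hn.1
  have hn0 : n' ≠ 0 := by
    intro h0
    rw [h0, norm_zero] at hn1
    exact zero_ne_one hn1
  have hu1 : ‖J n'‖ = 1 := by rw [J.norm_map, hn1]
  have hu0 : J n' ≠ 0 := by
    intro h0
    rw [h0, norm_zero] at hu1
    exact zero_ne_one hu1
  have hun : ⟪n', J n'⟫_ℝ = 0 := by rw [real_inner_comm, hJ]
  have hspan : ((J n' : normalSpace (minFace T x)) : E d) ∈ vectorSpan ℝ (A ∩ B) :=
    mem_vectorSpan_of_inner_eq_zero h.dim_eq.ge hn.ne_zero hn.2.1 hun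
  obtain ⟨β, hβ⟩ := exists_eq_smul_of_inner_eq_zero hN hn0 hu0 hun
    (b := m' - ⟪n', m'⟫_ℝ • n') (by
      rw [inner_sub_right, inner_smul_right, real_inner_self_eq_norm_sq, hn1]
      ring)
  have hβ' : m = ⟪n', m'⟫_ℝ • n + β • ((J n' : normalSpace (minFace T x)) : E d) := by
    have := congrArg Subtype.val (sub_eq_iff_eq_add'.1 hβ)
    exact this
  have hinner : ∀ y ∈ A ∩ B, ∀ r ∈ minFace T x,
      ⟪m, y⟫_ℝ - ⟪m, r⟫_ℝ = β * ⟪((J n' : normalSpace (minFace T x)) : E d), y - r⟫_ℝ := by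
    intro y hy r hr
    have h1 := mem_vectorSpan_orthogonal_iff.1 hn.2.1 y hy r
      ⟨minFace_subset h.1 hxA hr, minFace_subset h.2.1 hxB hr⟩
    rw [← inner_sub_right, hβ', inner_add_left, real_inner_smul_left, real_inner_smul_left,
      inner_sub_right n, h1]
    ring
  have hmax : ∀ y ∈ A ∩ B, ∀ r ∈ minFace T x, ⟪m, y⟫_ℝ - ⟪m, r⟫_ℝ ≤ 0 := by
    intro y hy r hr
    rw [hR] at hr
    exact sub_nonpos.2 (hr.2 y hy.1)
  rcases lt_trichotomy β 0 with hneg | rfl | hpos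
  · refine ⟨J n', hu1, hspan, fun y hy r hr => ?_⟩
    have h1 := hmax y hy r hr
    rw [hinner y hy r hr] at h1
    exact nonneg_of_mul_nonpos_right h1 hneg
  · exfalso
    have hsub : A ∩ B ⊆ minFace T x := by
      intro y hy
      have h1 := hinner y hy x (mem_minFace x)
      have hxR := mem_minFace (T := T) x
      rw [hR] at hxR ⊢
      refine ⟨hy.1, fun z hz => ?_⟩
      have := hxR.2 z hz
      linarith
    have h1 := dim_mono hsub
    have h2 := h.dim_eq
    omega
  · refine ⟨-J n', by rw [norm_neg, hu1], neg_mem hspan, fun y hy r hr => ?_⟩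
    have h1 := hmax y hy r hr
    rw [hinner y hy r hr] at h1
    rw [Submodule.coe_neg, inner_neg_left, neg_nonneg]
    exact nonpos_of_mul_nonpos_right h1 hpos

/-- `J u` and the facet normal are unit vectors of a plane orthogonal to `u`, hence equal up to
sign. The sign tells in which order the turn `J` passes through the two tiles. -/
lemma mem_orthogonal_quarterTurn (hT : IsParallelohedralTiling P T)
    (hx : dim (minFace T x) + 2 = d) (h : Adjacent T A B) (hxA : x ∈ A) (hxB : x ∈ B)
    {J : normalSpace (minFace T x) →ₗᵢ[ℝ] normalSpace (minFace T x)} (hJ : ∀ w, ⟪J w, w⟫_ℝ = 0)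
    {u : normalSpace (minFace T x)} (hu : IsRayDirection (minFace T x) (A ∩ B) u) :
    IsUnitNormal A B (J u) ∨ IsUnitNormal B A (J u) := by
  obtain ⟨n, hn, -⟩ := hT.exists_isUnitNormal_eq h
  let n' : normalSpace (minFace T x) :=
    ⟨n, Submodule.orthogonal_le (vectorSpan_minFace_le h hxA hxB) hn.2.1⟩
  have hu0 : u ≠ 0 := by
    intro h0
    have := hu.1
    rw [h0, norm_zero] at this
    exact zero_ne_one this
  have hn1 : ‖n'‖ = 1 := hn.1
  have hun : ⟪u, n'⟫_ℝ = 0 := (Submodule.mem_orthogonal _ _).1 hn.2.1 _ hu.2.1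
  rcases eq_or_eq_neg_of_inner_eq_zero (finrank_normalSpace hx) hu0 hn1
    (by rw [J.norm_map, hu.1]) hun (b := J u) (by rw [real_inner_comm, hJ]) with h1 | h1
  · rw [h1]
    exact Or.inl hn
  · rw [h1]
    exact Or.inr hn.neg

/-- The facet `A ∩ B'` leaves the ridge along `u'` and stays in `A`, on the inner side of `A ∩ B`.
The component of `J u` along `J u'` does not matter, since `⟪J u', ·⟫` is constant on `A ∩ B'`. -/
lemma inner_quarterTurn_nonpos (hx : dim (minFace T x) + 2 = d)
    {J : normalSpace (minFace T x) → normalSpace (minFace T x)} (hJ : ∀ w, ⟪J w, w⟫_ℝ = 0)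
    {B' : Set (E d)} {u u' : normalSpace (minFace T x)} (hxA : x ∈ A) (hxB : x ∈ B)
    (hxB' : x ∈ B') (hn : IsUnitNormal A B (J u)) (hn' : IsUnitNormal A B' (J u'))
    (hu' : IsRayDirection (minFace T x) (A ∩ B') u') : ⟪J u, u'⟫_ℝ ≤ 0 := by
  have hu'1 := hu'.1
  have hu'0 : u' ≠ 0 := by
    intro h0
    rw [h0, norm_zero] at hu'1
    exact zero_ne_one hu'1
  have hJ0 : J u' ≠ 0 := by
    intro h0
    have := hn'.1
    rw [h0] at this
    simp at this
  have hxR := mem_minFace (T := T) x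
  obtain ⟨y, hy, hpos⟩ : ∃ y ∈ A ∩ B', 0 < ⟪(u' : E d), y - x⟫_ℝ := by
    by_contra! hcon
    have h0 : ∀ y ∈ A ∩ B', ⟪(u' : E d), y⟫_ℝ = ⟪(u' : E d), x⟫_ℝ := fun y hy => by
      have := le_antisymm (hcon y hy) (hu'.2.2 y hy x hxR)
      rw [inner_sub_right] at this
      linarith
    have h1 : (u' : E d) ∈ (vectorSpan ℝ (A ∩ B'))ᗮ :=
      mem_vectorSpan_orthogonal_iff.2 fun y hy z hz => (h0 y hy).trans (h0 z hz).symm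
    have h2 := (Submodule.mem_orthogonal _ _).1 h1 _ hu'.2.1
    rw [inner_self_eq_zero] at h2
    exact hu'0 (Subtype.ext h2)
  obtain ⟨α, hα⟩ := exists_eq_smul_of_inner_eq_zero (finrank_normalSpace hx) hu'0 hJ0
    (by rw [real_inner_comm, hJ]) (b := J u - ⟪J u, u'⟫_ℝ • u') (by
      rw [inner_sub_right, inner_smul_right, real_inner_self_eq_norm_sq, hu'1,
        real_inner_comm (J u)]
      ring)
  have hα' : ((J u : normalSpace (minFace T x)) : E d) =
      ⟪J u, u'⟫_ℝ • (u' : E d) + α • ((J u' : normalSpace (minFace T x)) : E d) :=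
    congrArg Subtype.val (sub_eq_iff_eq_add'.1 hα)
  have h1 := hn.2.2 y hy.1 x hxB
  have h2 := mem_vectorSpan_orthogonal_iff.1 hn'.2.1 y hy x ⟨hxA, hxB'⟩
  have h3 : ⟪((J u : normalSpace (minFace T x)) : E d), y - x⟫_ℝ ≤ 0 := by
    rw [inner_sub_right]
    linarith
  rw [hα', inner_add_left, real_inner_smul_left, real_inner_smul_left,
    inner_sub_right (((J u' : normalSpace (minFace T x)) : E d)), h2, sub_self, mul_zero,
    add_zero] at h3
  exact nonpos_of_mul_nonpos_left h3 hpos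

/-- Going around a ridge in a fixed direction, one leaves each tile through one facet only. -/
lemma inter_eq_inter_of_quarterTurn (hT : IsParallelohedralTiling P T)
    (hx : dim (minFace T x) + 2 = d)
    {J : normalSpace (minFace T x) → normalSpace (minFace T x)}
    (hJ : ∀ w w', ⟪J w, w'⟫_ℝ = -⟪J w', w⟫_ℝ)
    {B' : Set (E d)} {u u' : normalSpace (minFace T x)} (h : Adjacent T A B)
    (h' : Adjacent T A B') (hxA : x ∈ A) (hxB : x ∈ B)
    (hxB' : x ∈ B') (hn : IsUnitNormal A B (J u)) (hn' : IsUnitNormal A B' (J u'))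
    (hu : IsRayDirection (minFace T x) (A ∩ B) u)
    (hu' : IsRayDirection (minFace T x) (A ∩ B') u') : A ∩ B = A ∩ B' := by
  have hJ0 : ∀ w, ⟪J w, w⟫_ℝ = 0 := fun w => by linarith [hJ w w]
  have h1 := inner_quarterTurn_nonpos hx hJ0 hxA hxB hxB' hn hn' hu'
  have h2 := inner_quarterTurn_nonpos hx hJ0 hxA hxB' hxB hn' hn hu
  have h3 := hJ u u'
  -- Both products are nonpositive and, by skewness, opposite to each other.
  have h4 : ⟪J u, u'⟫_ℝ = 0 := by linarith
  have hu'0 : u' ≠ 0 := by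
    intro h0
    have := hu'.1
    rw [h0, norm_zero] at this
    exact zero_ne_one this
  rcases eq_or_eq_neg_of_inner_eq_zero (finrank_normalSpace hx) hu'0 (a := J u') (b := J u)
    hn'.1 hn.1 (by rw [real_inner_comm, hJ0]) (by rw [real_inner_comm, h4]) with h5 | h5
  · rw [hT.inter_eq_of_isUnitNormal h hn, hT.inter_eq_of_isUnitNormal h' hn', h5]
  · refine (hT.not_const h.1 hn.1 (fun y hy => hn.2.2 y hy x hxB) fun y hy => ?_).elim
    have := hn'.2.2 y hy x hxB'
    rw [h5, Submodule.coe_neg, inner_neg_left, inner_neg_left, neg_le_neg_iff]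
    exact this

/-- The tiles at `x` are the vertices and the facets through the ridge the edges of a graph,
oriented by `J`. Each tile is left, and entered, through at most one facet, so
`exists_potential_of_sum_eq_zero` applies with the torsion identity as the sum condition. -/
lemma exists_isPotentialAt_of_ridge (hT : IsParallelohedralTiling P T)
    (hs : IsCanonicalScaling T s) (hx : dim (minFace T x) + 2 = d) :
    ∃ f, IsPotentialAt T s x f := by
  classical
  set R := minFace T x with hR
  have hxR : x ∈ R := mem_minFace x
  obtain ⟨J, hJ⟩ := exists_quarterTurn (finrank_normalSpace hx)
  have hskew : ∀ w w', ⟪J w, w'⟫_ℝ = -⟪J w', w⟫_ℝ := fun w w' => by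
    have := hJ (w + w')
    rw [map_add, inner_add_left, inner_add_right, inner_add_right, hJ, hJ] at this
    linarith
  obtain ⟨A₀, hA₀, hxA₀⟩ := hT.exists_mem x
  have hridge : IsRidge T R := ⟨⟨⟨x, hxR⟩, A₀, hA₀, hT.isExposed_minFace hA₀ hxA₀⟩, hx⟩
  set 𝓕 : Set (Set (E d)) := {F | IsFacet T F ∧ R ⊆ F} with h𝓕
  have hpair : ∀ F ∈ 𝓕, ∃ A B, Adjacent T A B ∧ A ∩ B = F ∧ x ∈ A ∧ x ∈ B := by
    rintro F ⟨⟨⟨hne, A, hA, hF⟩, hd⟩, hRF⟩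
    obtain ⟨B, hAB, rfl⟩ := hT.exists_adjacent hA hF hne hd
    exact ⟨A, B, hAB, rfl, (hRF hxR).1, (hRF hxR).2⟩
  have hmem𝓕 : ∀ A B, Adjacent T A B → x ∈ A → x ∈ B → A ∩ B ∈ 𝓕 := fun A B h hxA hxB =>
    ⟨h.2.2.2, Set.subset_inter (minFace_subset h.1 hxA) (minFace_subset h.2.1 hxB)⟩
  have hfin : 𝓕.Finite := by
    refine ((hT.finite_mem x).image2 (· ∩ ·) (hT.finite_mem x)).subset ?_
    intro F hF
    obtain ⟨A, B, hAB, rfl, hxA, hxB⟩ := hpair F hF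
    exact ⟨A, ⟨hAB.1, hxA⟩, B, ⟨hAB.2.1, hxB⟩, rfl⟩
  have hray : ∀ F ∈ 𝓕, ∃ u, IsRayDirection R F u := by
    intro F hF
    obtain ⟨A, B, hAB, rfl, hxA, hxB⟩ := hpair F hF
    exact hT.exists_isRayDirection hx hAB hxA hxB
  choose! u hu using hray
  have horient : ∀ F : 𝓕, ∃ p : {A ∈ T | x ∈ A} × {A ∈ T | x ∈ A},
      Adjacent T (p.1 : Set (E d)) p.2 ∧ (p.1 : Set (E d)) ∩ p.2 = F ∧
      IsUnitNormal (p.1 : Set (E d)) p.2 (J (u F)) := by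
    rintro ⟨F, hF⟩
    obtain ⟨A, B, hAB, rfl, hxA, hxB⟩ := hpair F hF
    rcases hT.mem_orthogonal_quarterTurn hx hAB hxA hxB hJ (hu _ hF) with h | h
    · exact ⟨(⟨A, hAB.1, hxA⟩, ⟨B, hAB.2.1, hxB⟩), hAB, rfl, h⟩
    · exact ⟨(⟨B, hAB.2.1, hxB⟩, ⟨A, hAB.1, hxA⟩), hAB.symm, Set.inter_comm _ _, h⟩
  choose p hp1 hp2 hp3 using horient
  have : Fintype 𝓕 := hfin.fintype
  have : Fintype {A ∈ T | x ∈ A} := (hT.finite_mem x).fintype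
  have hsrc : Function.Injective fun F => (p F).1 := by
    intro F F' hFF'
    have h2 := hp1 F'
    have h2' := hp2 F'
    have h2'' := hp3 F'
    simp only at hFF'
    rw [← hFF'] at h2 h2' h2''
    apply Subtype.ext
    rw [← hp2 F, ← h2']
    exact hT.inter_eq_inter_of_quarterTurn hx hskew (hp1 F) h2 (p F).1.2.2 (p F).2.2.2
      (p F').2.2.2 (hp3 F) h2'' (by rw [hp2 F]; exact hu F F.2)
      (by rw [h2']; exact hu F' F'.2)
  have htgt : Function.Injective fun F => (p F).2 := by
    intro F F' hFF'
    have h2 := hp1 F'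
    have h2' := hp2 F'
    have h2'' := hp3 F'
    simp only at hFF'
    rw [← hFF'] at h2 h2' h2''
    apply Subtype.ext
    rw [← hp2 F, ← h2', Set.inter_comm, Set.inter_comm ((p F').1 : Set (E d))]
    -- Entering facets are leaving facets for the opposite turn `-J`.
    exact hT.inter_eq_inter_of_quarterTurn hx (J := fun w => -J w) (u := u F) (u' := u F')
      (fun w w' => by rw [inner_neg_left, inner_neg_left, hskew w w'])
      (hp1 F).symm h2.symm (p F).2.2.2 (p F).1.2.2
      (p F').1.2.2 (hp3 F).neg h2''.neg (by rw [Set.inter_comm, hp2 F]; exact hu F F.2)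
      (by rw [Set.inter_comm, h2']; exact hu F' F'.2)
  have hcases : ∀ A B (h : Adjacent T A B) (hxA : x ∈ A) (hxB : x ∈ B),
      (p ⟨A ∩ B, hmem𝓕 A B h hxA hxB⟩ = (⟨A, h.1, hxA⟩, ⟨B, h.2.1, hxB⟩)) ∨
      (p ⟨A ∩ B, hmem𝓕 A B h hxA hxB⟩ = (⟨B, h.2.1, hxB⟩, ⟨A, h.1, hxA⟩)) := by
    intro A B h hxA hxB
    set F : 𝓕 := ⟨A ∩ B, hmem𝓕 A B h hxA hxB⟩ with hF
    have h1 : A ∩ B ⊆ (p F).1 := by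
      rw [show A ∩ B = (F : Set (E d)) from rfl, ← hp2 F]
      exact Set.inter_subset_left
    have h2 : A ∩ B ⊆ (p F).2 := by
      rw [show A ∩ B = (F : Set (E d)) from rfl, ← hp2 F]
      exact Set.inter_subset_right
    have hne := (hp1 F).2.2.1
    rcases hT.eq_or_eq_of_subset h (p F).1.2.1 h.nonempty h.dim_eq.ge Set.inter_subset_left
      Set.inter_subset_right h1 with h3 | h3 <;>
    rcases hT.eq_or_eq_of_subset h (p F).2.2.1 h.nonempty h.dim_eq.ge Set.inter_subset_left
      Set.inter_subset_right h2 with h4 | h4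
    · exact absurd (h3.trans h4.symm) hne
    · exact Or.inl (Prod.ext (Subtype.ext h3) (Subtype.ext h4))
    · exact Or.inr (Prod.ext (Subtype.ext h3) (Subtype.ext h4))
    · exact absurd (h3.trans h4.symm) hne
  let w : 𝓕 → E d × ℝ := fun F =>
    (s F • ((J (u F) : normalSpace R) : E d),
      -(s F * ⟪((J (u F) : normalSpace R) : E d), x⟫_ℝ))
  have hsum : ∑ F, w F = 0 := by
    have h0 := hs.torsion_eq_zero R hridge J hJ u fun F hF hRF => hu F ⟨hF, hRF⟩
    rw [torsion, ← finsum_set_coe_eq_finsum_mem 𝓕, finsum_eq_sum_of_fintype] at h0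
    ext1
    · rw [Prod.fst_sum]
      exact h0
    · rw [Prod.snd_sum]
      -- All these facets contain `x`, so the constant term of each jump is minus the product of its
      -- gradient with `x`, and zero torsion makes the constants cancel as well.
      have h1 := congrArg (fun v => -⟪v, x⟫_ℝ) h0
      simp only [sum_inner, real_inner_smul_left, inner_zero_left, neg_zero] at h1
      rw [← Finset.sum_neg_distrib] at h1
      exact h1
  obtain ⟨f, hf⟩ := exists_potential_of_sum_eq_zero (fun F => (p F).1) (fun F => (p F).2) hsrc
    htgt ⟨A₀, hA₀, hxA₀⟩ (by
      rintro φ hφ ⟨B, hB⟩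
      refine hT.forall_of_adjacent_at x
        (fun C => ∀ hC : C ∈ {A ∈ T | x ∈ A}, φ ⟨C, hC⟩ = φ ⟨A₀, hA₀, hxA₀⟩) ?_ hA₀ hxA₀
        (fun _ => rfl) hB.1 hB.2 hB
      intro C D hCD hxC hxD h hD
      have h1 := hφ ⟨C ∩ D, hmem𝓕 C D hCD hxC hxD⟩
      rcases hcases C D hCD hxC hxD with h2 | h2
      · rw [h2] at h1
        exact h1.trans (h _)
      · rw [h2] at h1
        exact h1.symm.trans (h _)) w hsum
  refine ⟨fun C => if hC : C ∈ {A ∈ T | x ∈ A} then f ⟨C, hC⟩ else 0, fun A B h hxA hxB => ?_⟩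
  have hA' : A ∈ {A ∈ T | x ∈ A} := ⟨h.1, hxA⟩
  have hB' : B ∈ {A ∈ T | x ∈ A} := ⟨h.2.1, hxB⟩
  beta_reduce
  rw [dif_pos hA', dif_pos hB']
  have h1 := hf ⟨A ∩ B, hmem𝓕 A B h hxA hxB⟩
  have h3 := hp3 ⟨A ∩ B, hmem𝓕 A B h hxA hxB⟩
  rcases hcases A B h hxA hxB with h2 | h2
  · rw [h2] at h1 h3
    rw [h1, hT.jump_eq h h3 ⟨hxA, hxB⟩]
  · rw [h2] at h1 h3
    rw [← neg_sub, h1, hT.jump_symm h.symm, hT.jump_eq h.symm h3 ⟨hxB, hxA⟩, Set.inter_comm B A]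

end Ridge

lemma exists_isPotentialAt (hT : IsParallelohedralTiling P T) (hs : IsCanonicalScaling T s)
    {x : E d} (hx : x ∈ good T) : ∃ f, IsPotentialAt T s x f := by
  have hx' : d ≤ dim (minFace T x) + 2 := hx
  by_cases h : d ≤ dim (minFace T x) + 1
  · exact hT.exists_isPotentialAt_of_facet h
  · exact hT.exists_isPotentialAt_of_ridge hs (by omega)

end IsParallelohedralTiling

end Tiling

/-! ### From local to global potentials -/

/-- The jumps across facets come from a potential near all points of `S`. -/
def IsExactOn (T : Set (Set (E d))) (s : Set (E d) → ℝ) (S : Set (E d)) : Prop :=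
  ∃ f, ∀ x ∈ S, IsPotentialAt T s x f

lemma IsExactOn.mono {T : Set (Set (E d))} {s : Set (E d) → ℝ} {S S' : Set (E d)}
    (h : IsExactOn T s S) (hS : S' ⊆ S) : IsExactOn T s S' := by
  obtain ⟨f, hf⟩ := h
  exact ⟨f, fun x hx => hf x (hS hx)⟩

lemma IsPotentialAt.add_const {T : Set (Set (E d))} {s : Set (E d) → ℝ} {x : E d}
    {f : Set (E d) → E d × ℝ} (h : IsPotentialAt T s x f) (k : E d × ℝ) :
    IsPotentialAt T s x (fun A => f A + k) := by
  intro A B hAB hxA hxB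
  rw [← h A B hAB hxA hxB, add_sub_add_right_eq_sub]

section Tiling

variable {P : Set (E d)} {T : Set (Set (E d))} {A B C : Set (E d)} {s : Set (E d) → ℝ}

namespace IsParallelohedralTiling

lemma isOpen_isPotentialAt (hT : IsParallelohedralTiling P T) (f : Set (E d) → E d × ℝ) :
    IsOpen {x | IsPotentialAt T s x f} := by
  rw [Metric.isOpen_iff]
  intro x hx
  obtain ⟨ε, hε, hb⟩ := hT.exists_ball x
  refine ⟨ε, hε, fun y hy A B hAB hyA hyB => ?_⟩
  exact hx A B hAB (hb A hAB.1 ⟨y, hyA, hy⟩) (hb B hAB.2.1 ⟨y, hyB, hy⟩)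

lemma potential_unique (hT : IsParallelohedralTiling P T) {S : Set (E d)} (hS : IsPreconnected S)
    {f f' : Set (E d) → E d × ℝ} (hf : ∀ x ∈ S, IsPotentialAt T s x f)
    (hf' : ∀ x ∈ S, IsPotentialAt T s x f') (hA : A ∈ T) (hAS : (A ∩ S).Nonempty) (hB : B ∈ T)
    (hBS : (B ∩ S).Nonempty) : f B - f' B = f A - f' A := by
  refine hT.forall_of_isPreconnected hS (fun C => f C - f' C = f A - f' A) ?_ hA hAS rfl hB hBS
  intro w hw C hC D hD hwC hwD h
  rw [← h]
  exact hT.isPotentialAt_unique (hf w hw) (hf' w hw) hC hwC hD hwD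

/-- On the slice `l = a`, which is convex and so connected, the two potentials differ by a constant;
shifting one of them makes them agree. A tile meeting both halves of `S` meets the slice, because
its intersection with `S` is convex. -/
lemma isExactOn_of_cut (hT : IsParallelohedralTiling P T) {S : Set (E d)} (hS : Convex ℝ S)
    (l : E d →L[ℝ] ℝ) (a : ℝ) (h1 : IsExactOn T s (S ∩ {x | l x ≤ a}))
    (h2 : IsExactOn T s (S ∩ {x | a ≤ l x})) : IsExactOn T s S := by
  classical
  obtain ⟨f₁, hf₁⟩ := h1
  obtain ⟨f₂, hf₂⟩ := h2
  have hconv : Convex ℝ (S ∩ {x | l x = a}) :=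
    hS.inter (convex_hyperplane l.toLinearMap.isLinear a)
  obtain ⟨k, hk⟩ : ∃ k, ∀ A ∈ T, (A ∩ (S ∩ {x | l x = a})).Nonempty → f₁ A = f₂ A + k := by
    by_cases hne : (S ∩ {x | l x = a}).Nonempty
    · obtain ⟨z, hz⟩ := hne
      obtain ⟨A₀, hA₀, hzA₀⟩ := hT.exists_mem z
      refine ⟨f₁ A₀ - f₂ A₀, fun A hA hAS => ?_⟩
      rw [← hT.potential_unique hconv.isPreconnected
        (fun x hx => hf₁ x ⟨hx.1, hx.2.le⟩) (fun x hx => hf₂ x ⟨hx.1, hx.2.ge⟩) hA₀ ⟨z, hzA₀, hz⟩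
        hA hAS]
      abel
    · exact ⟨0, fun A _ hAS => absurd (hAS.mono Set.inter_subset_right) hne⟩
  have hcross : ∀ A ∈ T, (A ∩ (S ∩ {x | l x ≤ a})).Nonempty → (A ∩ (S ∩ {x | a ≤ l x})).Nonempty →
      (A ∩ (S ∩ {x | l x = a})).Nonempty := by
    rintro A hA ⟨x, hxA, hxS, hx⟩ ⟨y, hyA, hyS, hy⟩
    obtain ⟨z, ⟨hzA, hzS⟩, hz⟩ := ((hT.convex hA).inter hS).isPreconnected.intermediate_value
      (f := l) ⟨hxA, hxS⟩ ⟨hyA, hyS⟩ l.continuous.continuousOn ⟨hx, hy⟩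
    exact ⟨z, hzA, hzS, hz⟩
  refine ⟨fun A => if (A ∩ (S ∩ {x | l x ≤ a})).Nonempty then f₁ A else f₂ A + k, ?_⟩
  intro x hxS
  rcases le_total (l x) a with hxa | hxa
  · intro A B hAB hxA hxB
    beta_reduce
    rw [if_pos ⟨x, hxB, hxS, hxa⟩, if_pos ⟨x, hxA, hxS, hxa⟩]
    exact hf₁ x ⟨hxS, hxa⟩ A B hAB hxA hxB
  · have h : ∀ A ∈ T, x ∈ A →
        (if (A ∩ (S ∩ {x | l x ≤ a})).Nonempty then f₁ A else f₂ A + k) = f₂ A + k := by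
      intro A hA hxA
      split_ifs with h
      · exact hk A hA (hcross A hA h ⟨x, hxA, hxS, hxa⟩)
      · rfl
    intro A B hAB hxA hxB
    beta_reduce
    rw [h A hAB.1 hxA, h B hAB.2.1 hxB]
    exact (hf₂ x ⟨hxS, hxa⟩).add_const k A B hAB hxA hxB

/-- Being a potential is an open condition, so by compactness a potential for one slice serves for a
slab around it. Finitely many slabs cover `S` and are glued one after another by `isExactOn_of_cut`.
-/
lemma isExactOn_of_slices (hT : IsParallelohedralTiling P T) {S : Set (E d)} (hS : Convex ℝ S)
    (hSc : IsCompact S) (l : E d →L[ℝ] ℝ) (h : ∀ a, IsExactOn T s (S ∩ {x | l x = a})) :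
    IsExactOn T s S := by
  choose f hf using h
  -- `O a` consists of the levels at which `f a` is a potential on the entire slice of `S`.
  let O : ℝ → Set ℝ := fun a => (l '' (S \ {x | IsPotentialAt T s x (f a)}))ᶜ
  have hO : ∀ a, IsOpen (O a) := fun a =>
    ((hSc.diff (hT.isOpen_isPotentialAt (f a))).image l.continuous).isClosed.isOpen_compl
  have haO : ∀ a, a ∈ O a := by
    rintro a ⟨x, ⟨hxS, hx⟩, hxa⟩
    exact hx (hf a x ⟨hxS, hxa⟩)
  have hexact : ∀ a, IsExactOn T s (S ∩ l ⁻¹' O a) := by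
    refine fun a => ⟨f a, fun x hx => ?_⟩
    by_contra hcon
    exact hx.2 ⟨x, ⟨hx.1, hcon⟩, rfl⟩
  rcases S.eq_empty_or_nonempty with rfl | hne
  · exact (hexact 0).mono (by simp)
  obtain ⟨x₀, hx₀, hlo⟩ := hSc.exists_isMinOn hne l.continuous.continuousOn
  obtain ⟨x₁, hx₁, hhi⟩ := hSc.exists_isMaxOn hne l.continuous.continuousOn
  obtain ⟨t, ht0, htm, ⟨m, hm⟩, ht⟩ := exists_monotone_Icc_subset_open_cover_Icc
    (a := l x₀) (b := l x₁) (hlo hx₁) (c := fun a => Subtype.val ⁻¹' O a)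
    (fun a => (hO a).preimage continuous_subtype_val)
    (fun z _ => Set.mem_iUnion.2 ⟨z, haO z⟩)
  have key : ∀ n, IsExactOn T s (S ∩ {x | l x ≤ t n}) := by
    intro n
    induction n with
    | zero =>
      refine (hexact (l x₀)).mono ?_
      rintro x ⟨hxS, hx⟩
      have hx' : l x ≤ l x₀ := ht0 ▸ hx
      have : l x = l x₀ := le_antisymm hx' (hlo hxS)
      exact ⟨hxS, by rw [Set.mem_preimage, this]; exact haO _⟩
    | succ n ih =>
      refine hT.isExactOn_of_cut
        (hS.inter (convex_halfSpace_le l.toLinearMap.isLinear _)) l (t n) (ih.mono ?_) ?_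
      · rintro x ⟨⟨hxS, -⟩, hx⟩
        exact ⟨hxS, hx⟩
      · obtain ⟨i, hi⟩ := ht n
        refine (hexact i).mono ?_
        rintro x ⟨⟨hxS, hx1⟩, hx2⟩
        refine ⟨hxS, ?_⟩
        exact @hi ⟨l x, hlo hxS, hhi hxS⟩ ⟨hx2, hx1⟩
  refine (key m).mono fun x hxS => ⟨hxS, ?_⟩
  have h1 : (t m : ℝ) = l x₁ := hm m le_rfl
  rw [Set.mem_ofPred_eq, h1]
  exact hhi hxS

/-- On a compact convex set that avoids the faces of codimension at least three the jumps come
from a potential. -/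
lemma isExactOn_of_convex (hT : IsParallelohedralTiling P T) (hs : IsCanonicalScaling T s)
    {S : Set (E d)} (hS : Convex ℝ S) (hSc : IsCompact S) (hgood : S ⊆ good T) :
    IsExactOn T s S := by
  -- Induction on the number `k` of coordinates allowed to vary on `S`; slicing by the last of them
  -- fixes it.
  suffices h : ∀ k : ℕ, ∀ S : Set (E d), Convex ℝ S → IsCompact S → S ⊆ good T →
      (∀ x ∈ S, ∀ y ∈ S, ∀ i : Fin d, k ≤ i → x i = y i) → IsExactOn T s S from
    h d S hS hSc hgood fun x _ y _ i hi => absurd i.2 (not_lt.2 hi)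
  intro k
  induction k with
  | zero =>
    intro S _ _ hgood hconst
    rcases S.eq_empty_or_nonempty with rfl | ⟨x, hx⟩
    · exact ⟨fun _ => 0, by simp⟩
    obtain ⟨f, hf⟩ := hT.exists_isPotentialAt hs (hgood hx)
    refine ⟨f, fun y hy => ?_⟩
    have : y = x := by
      ext i
      exact hconst y hy x hx i (Nat.zero_le _)
    rwa [this]
  | succ k ih =>
    intro S hS hSc hgood hconst
    by_cases hk : k < d
    · let l : E d →L[ℝ] ℝ := EuclideanSpace.proj (⟨k, hk⟩ : Fin d)
      refine hT.isExactOn_of_slices hS hSc l fun a => ih _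
        (hS.inter (convex_hyperplane l.toLinearMap.isLinear a))
        (hSc.inter_right (isClosed_eq l.continuous continuous_const))
        (Set.inter_subset_left.trans hgood) ?_
      rintro x ⟨hxS, hx⟩ y ⟨hyS, hy⟩ i hi
      rcases hi.eq_or_lt with hi | hi
      · have h1 : i = ⟨k, hk⟩ := Fin.ext hi.symm
        rw [h1]
        exact hx.trans hy.symm
      · exact hconst x hxS y hyS i hi
    · exact ih S hS hSc hgood fun x _ y _ i hi => absurd i.2 (by omega)

lemma minFace_eq_of_mem_interior (hT : IsParallelohedralTiling P T) (hA : A ∈ T) {x : E d}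
    (hx : x ∈ interior A) : minFace T x = A := by
  refine (minFace_subset hA (interior_subset hx)).antisymm fun y hy B hB => ?_
  rwa [hT.eq_of_mem_interior hB.1 hA hB.2 hx]

/-- A canonical scaling is the system of jumps of affine functions on the tiles. -/
theorem exists_potential (hT : IsParallelohedralTiling P T) (hs : IsCanonicalScaling T s)
    {P₀ : Set (E d)} (hP₀ : P₀ ∈ T) :
    ∃ Φ : Set (E d) → E d × ℝ, Φ P₀ = 0 ∧ ∀ A B, Adjacent T A B → Φ B - Φ A = jump s A B := by
  obtain ⟨p, hp⟩ := hT.interior_nonempty hP₀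
  have hp' := interior_subset hp
  have hnorm : ∀ S : Set (E d), p ∈ S → Convex ℝ S → IsCompact S → S ⊆ good T →
      ∃ f, f P₀ = 0 ∧ ∀ w ∈ S, IsPotentialAt T s w f := by
    intro S _ h1 h2 h3
    obtain ⟨f, hf⟩ := hT.isExactOn_of_convex hs h1 h2 h3
    exact ⟨fun A => f A + -f P₀, by simp, fun w hw => (hf w hw).add_const _⟩
  have hseg : ∀ x, segment ℝ p x ⊆ good T →
      ∃ f, f P₀ = 0 ∧ ∀ w ∈ segment ℝ p x, IsPotentialAt T s w f := fun x hx =>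
    hnorm _ (left_mem_segment ℝ p x) (convex_segment p x)
      (by rw [← convexHull_pair]; exact (Set.toFinite _).isCompact_convexHull ℝ) hx
  choose! f hf0 hf using hseg
  -- A triangle carries one potential vanishing at `P₀`, which by uniqueness agrees with the
  -- potentials along its two sides at `p`.
  have htri : ∀ x y A B, A ∈ T → B ∈ T → x ∈ A → y ∈ B → convexHull ℝ {p, x, y} ⊆ good T →
      ∃ g, (∀ w ∈ convexHull ℝ {p, x, y}, IsPotentialAt T s w g) ∧ g A = f x A ∧ g B = f y B := by
    intro x y A B hA hB hxA hyB hgood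
    obtain ⟨g, hg0, hg⟩ := hnorm _ (subset_convexHull ℝ _ (by simp)) (convex_convexHull ℝ _)
      ((Set.toFinite {p, x, y}).isCompact_convexHull ℝ) hgood
    have hres : ∀ z ∈ ({p, x, y} : Set (E d)), ∀ C ∈ T, z ∈ C → g C = f z C := by
      intro z hz C hC hzC
      have hsub : segment ℝ p z ⊆ convexHull ℝ {p, x, y} :=
        segment_subset_convexHull (by simp) hz
      have := hT.potential_unique (convex_segment p z).isPreconnected
        (fun w hw => hg w (hsub hw)) (hf z (hsub.trans hgood)) hP₀
        ⟨p, hp', left_mem_segment ℝ p z⟩ hC ⟨z, hzC, right_mem_segment ℝ p z⟩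
      rw [hg0, hf0 z (hsub.trans hgood), sub_zero] at this
      exact sub_eq_zero.1 this
    exact ⟨g, hg, hres x (by simp) A hA hxA, hres y (by simp) B hB hyB⟩
  have hpgood : p ∈ good T := by
    rw [good, Set.mem_ofPred_eq, hT.minFace_eq_of_mem_interior hP₀ hp, hT.dim_eq hP₀]
    omega
  have hpt : ∀ A ∈ T, ∃ x ∈ A, segment ℝ p x ⊆ good T := by
    intro A hA
    obtain ⟨x, hx, h⟩ := hT.exists_segment p isOpen_interior (hT.interior_nonempty hA)
    refine ⟨x, interior_subset hx, fun w hw => ?_⟩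
    by_cases hwp : w = p
    · rwa [hwp]
    · exact (h w hw hwp).trans (by omega)
  choose! pt hptA hpt using hpt
  have hside : ∀ x y, convexHull ℝ {p, x, y} ⊆ good T → segment ℝ p y ⊆ good T :=
    fun x y h => (segment_subset_convexHull (by simp) (by simp)).trans h
  refine ⟨fun A => f (pt A) A, ?_, fun A B hAB => ?_⟩
  · exact hf0 _ (hpt P₀ hP₀)
  · have hA := hAB.1
    have hB := hAB.2.1
    -- Near a point of the facet choose `x` in `A` and `y` in `B` such that the triangles `p, pt A,
    -- x`, `p, x, y` and `p, pt B, y` are all good. The first and last show that the values do not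
    -- depend on the chosen points; in the middle one `[x, y]` stays in `A ∪ B` and so crosses `A ∩
    -- B`, where the jump is read off.
    obtain ⟨w, hw, ε, hε, hball⟩ := hT.exists_ball_subset_union hAB
    obtain ⟨x, ⟨hxA, hxε⟩, hx, -⟩ := hT.exists_triangle (hpt A hA) (hpt A hA)
      (isOpen_interior.inter Metric.isOpen_ball)
      (hT.inter_interior_nonempty hA Metric.isOpen_ball ⟨w, hw.1, Metric.mem_ball_self hε⟩)
    obtain ⟨y, ⟨hyB, hyε⟩, hxy, hy⟩ := hT.exists_triangle (hside _ _ hx) (hpt B hB)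
      (isOpen_interior.inter Metric.isOpen_ball)
      (hT.inter_interior_nonempty hB Metric.isOpen_ball ⟨w, hw.2, Metric.mem_ball_self hε⟩)
    have hxA' := interior_subset hxA
    have hyB' := interior_subset hyB
    obtain ⟨g₁, -, h1, h1'⟩ := htri _ x A A hA hA (hptA A hA) hxA' hx
    obtain ⟨g₂, -, h2, h2'⟩ := htri _ y B B hB hB (hptA B hB) hyB' hy
    obtain ⟨g, hg, h3, h3'⟩ := htri x y A B hA hB hxA' hyB' hxy
    obtain ⟨z, hz, hzA, hzB⟩ := isPreconnected_closed_iff.1 (convex_segment x y).isPreconnected A B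
      (hT.isClosed hA) (hT.isClosed hB)
      (((convex_ball w ε).segment_subset hxε hyε).trans hball)
      ⟨x, left_mem_segment ℝ x y, hxA'⟩ ⟨y, right_mem_segment ℝ x y, hyB'⟩
    have h4 := hg z (segment_subset_convexHull (by simp) (by simp) hz) A B hAB hzA hzB
    beta_reduce
    rw [← h4, h3, h3', ← h1, h1', ← h2, h2']

end IsParallelohedralTiling

end Tiling

/-! ### Convexity -/

/-- The affine function with gradient `φ.1` and value `φ.2` at the origin. -/
def affineEval (φ : E d × ℝ) (x : E d) : ℝ := ⟪φ.1, x⟫_ℝ + φ.2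

lemma affineEval_sub (φ ψ : E d × ℝ) (x : E d) :
    affineEval (φ - ψ) x = affineEval φ x - affineEval ψ x := by
  simp only [affineEval, Prod.fst_sub, Prod.snd_sub, inner_sub_left]
  ring

section Tiling

variable {P : Set (E d)} {T : Set (Set (E d))} {A B C : Set (E d)} {s : Set (E d) → ℝ}

/-- `Φ` gives affine functions on the tiles with the prescribed jumps across all facets. -/
def IsPotential (T : Set (Set (E d))) (s : Set (E d) → ℝ) (Φ : Set (E d) → E d × ℝ) : Prop :=
  ∀ A B, Adjacent T A B → Φ B - Φ A = jump s A B

namespace IsParallelohedralTiling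

variable {Φ : Set (E d) → E d × ℝ}

lemma affineEval_jump (hT : IsParallelohedralTiling P T) (h : Adjacent T A B) {n w : E d}
    (hn : IsUnitNormal A B n) (hw : w ∈ A ∩ B) (x : E d) :
    affineEval (jump s A B) x = s (A ∩ B) * (⟪n, x⟫_ℝ - ⟪n, w⟫_ℝ) := by
  rw [hT.jump_eq h hn hw, affineEval, real_inner_smul_left]
  ring

lemma affineEval_sub_eq (hT : IsParallelohedralTiling P T) (hΦ : IsPotential T s Φ)
    (h : Adjacent T A B) {n w : E d} (hn : IsUnitNormal A B n) (hw : w ∈ A ∩ B) (x : E d) :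
    affineEval (Φ B) x - affineEval (Φ A) x = s (A ∩ B) * (⟪n, x⟫_ℝ - ⟪n, w⟫_ℝ) := by
  rw [← affineEval_sub, hΦ A B h, hT.affineEval_jump h hn hw]

/-- A jump vanishes on its facet, and the tiles at `x` are connected through facets containing `x`.
-/
lemma affineEval_eq_of_mem (hT : IsParallelohedralTiling P T) (hΦ : IsPotential T s Φ)
    (hA : A ∈ T) (hB : B ∈ T) {x : E d} (hxA : x ∈ A) (hxB : x ∈ B) :
    affineEval (Φ B) x = affineEval (Φ A) x := by
  refine hT.forall_of_adjacent_at x (fun C => affineEval (Φ C) x = affineEval (Φ A) x) ?_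
    hA hxA rfl hB hxB
  intro C D hCD hxC hxD h
  obtain ⟨n, hn, -⟩ := hT.exists_isUnitNormal_eq hCD
  have := hT.affineEval_sub_eq hΦ hCD hn ⟨hxC, hxD⟩ x
  rw [sub_self, mul_zero, h] at this
  linarith

/-- Leave `C` towards `x` at its point `w` nearest to `x`. By the choice of the segment the next
tile `D` shares a facet with `C`, and `x` is strictly on the side of `D`, so the jump at `x` is
positive. -/
lemma exists_affineEval_lt (hT : IsParallelohedralTiling P T) (hs : IsCanonicalScaling T s)
    (hΦ : IsPotential T s Φ) {x y : E d}
    (hxy : ∀ w ∈ segment ℝ x y, w ≠ x → d ≤ dim (minFace T w) + 1) (hC : C ∈ T)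
    (hCS : (C ∩ segment ℝ x y).Nonempty) (hxC : x ∉ C) :
    ∃ D ∈ T, (D ∩ segment ℝ x y).Nonempty ∧ affineEval (Φ C) x < affineEval (Φ D) x := by
  have hcomp : IsCompact (C ∩ segment ℝ x y) := by
    refine (hT.isCompact hC).inter_right ?_
    rw [← convexHull_pair]
    exact (Set.toFinite _).isClosed_convexHull ℝ
  obtain ⟨w, ⟨hwC, hwS⟩, hmin⟩ := hcomp.exists_isMinOn hCS
    (f := fun z => dist z x) (by fun_prop)
  have hwx : w ≠ x := fun h => hxC (h ▸ hwC)
  have hdist : 0 < dist w x := dist_pos.2 hwx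
  obtain ⟨ε, hε, hb⟩ := hT.exists_ball w
  set t : ℝ := min (1 / 2) (ε / (2 * dist w x)) with ht
  have ht0 : 0 < t := by positivity
  have ht1 : t ≤ 1 / 2 := min_le_left _ _
  have ht2 : t * dist w x < ε := by
    have h1 : t ≤ ε / (2 * dist w x) := min_le_right _ _
    rw [le_div_iff₀ (by positivity)] at h1
    linarith
  set z := AffineMap.lineMap w x t with hz
  have hzw : z = w + t • (x - w) := by
    rw [hz, AffineMap.lineMap_apply]
    simp [add_comm]
  have hzS : z ∈ segment ℝ x y := by
    refine (convex_segment x y).segment_subset hwS (left_mem_segment ℝ x y) ?_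
    rw [segment_eq_image_lineMap]
    exact ⟨t, ⟨ht0.le, by linarith⟩, rfl⟩
  have hzC : z ∉ C := by
    intro hzC
    have h1 : dist w x ≤ dist z x := hmin ⟨hzC, hzS⟩
    rw [hz, dist_lineMap_right, Real.norm_eq_abs, abs_of_pos (by linarith)] at h1
    nlinarith
  obtain ⟨D, hD, hzD⟩ := hT.exists_mem z
  have hwD : w ∈ D := by
    refine hb D hD ⟨z, hzD, ?_⟩
    rw [Metric.mem_ball, hz, dist_lineMap_left, Real.norm_eq_abs, abs_of_pos ht0]
    exact ht2
  have hCD : C ≠ D := by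
    rintro rfl
    exact hzC hzD
  have hadj : Adjacent T C D := by
    refine hT.adjacent_of_le_dim hC hD hCD ⟨w, hwC, hwD⟩ ((hxy w hwS hwx).trans ?_)
    exact Nat.add_le_add_right
      (dim_mono (Set.subset_inter (minFace_subset hC hwC) (minFace_subset hD hwD))) 1
  obtain ⟨n, hn, -⟩ := hT.exists_isUnitNormal_eq hadj
  refine ⟨D, hD, ⟨z, hzD, hzS⟩, ?_⟩
  have h1 : ⟪n, w⟫_ℝ ≤ ⟪n, z⟫_ℝ := hn.2.2 w hwC z hzD
  have h2 : ⟪n, w⟫_ℝ ≠ ⟪n, z⟫_ℝ := by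
    intro heq
    exact hzC (hT.mem_of_inner_eq hadj.symm hn.neg ⟨hwD, hwC⟩ hzD
      (by rw [inner_neg_left, inner_neg_left, heq]))
  have h3 : 0 < ⟪n, x⟫_ℝ - ⟪n, w⟫_ℝ := by
    have h4 := lt_of_le_of_ne h1 h2
    rw [hzw, inner_add_right, inner_smul_right, inner_sub_right] at h4
    exact (pos_iff_pos_of_mul_pos (by linarith : 0 < t * (⟪n, x⟫_ℝ - ⟪n, w⟫_ℝ))).1 ht0
  have h4 := hT.affineEval_sub_eq hΦ hadj hn ⟨hwC, hwD⟩ x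
  have h5 := mul_pos (hs.pos _ hadj.2.2.2) h3
  linarith

/-- The affine function of the tile at `x` is the largest one at `x`. -/
lemma affineEval_lt (hT : IsParallelohedralTiling P T) (hs : IsCanonicalScaling T s)
    (hΦ : IsPotential T s Φ) (hA : A ∈ T) (hB : B ∈ T) {x : E d} (hxA : x ∈ A) (hxB : x ∉ B) :
    affineEval (Φ B) x < affineEval (Φ A) x := by
  obtain ⟨y, hy, hxy⟩ := hT.exists_segment x isOpen_interior (hT.interior_nonempty hB)
  have hfin : {C ∈ T | (C ∩ segment ℝ x y).Nonempty}.Finite := by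
    refine hT.finite_inter_nonempty ?_
    rw [← convexHull_pair]
    exact ((Set.toFinite _).isCompact_convexHull ℝ).isBounded
  have hBS : (B ∩ segment ℝ x y).Nonempty := ⟨y, interior_subset hy, right_mem_segment ℝ x y⟩
  -- A tile along the segment that is maximal at `x` must contain `x`, since otherwise the previous
  -- lemma produces a larger one.
  obtain ⟨C, ⟨hC, hCS⟩, hmax⟩ := Set.exists_max_image _ (fun C => affineEval (Φ C) x) hfin
    ⟨B, hB, hBS⟩
  have hxC : x ∈ C := by
    by_contra hxC
    obtain ⟨D, hD, hDS, hlt⟩ := hT.exists_affineEval_lt hs hΦ hxy hC hCS hxC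
    exact (hmax D ⟨hD, hDS⟩).not_gt hlt
  obtain ⟨D, hD, hDS, hlt⟩ := hT.exists_affineEval_lt hs hΦ hxy hB hBS hxB
  rw [← hT.affineEval_eq_of_mem hΦ hA hC hxA hxC]
  exact hlt.trans_le (hmax D ⟨hD, hDS⟩)

lemma affineEval_le (hT : IsParallelohedralTiling P T) (hs : IsCanonicalScaling T s)
    (hΦ : IsPotential T s Φ) (hA : A ∈ T) (hB : B ∈ T) {x : E d} (hxA : x ∈ A) :
    affineEval (Φ B) x ≤ affineEval (Φ A) x := by
  by_cases hxB : x ∈ B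
  · exact (hT.affineEval_eq_of_mem hΦ hA hB hxA hxB).le
  · exact (hT.affineEval_lt hs hΦ hA hB hxA hxB).le

end IsParallelohedralTiling

end Tiling

/-! ### The lattice of translations -/

/-- Translation by `v` would raise the maximum of `⟪v, ·⟫` on `A` by `⟪v, v⟫`. -/
lemma eq_zero_of_vadd_subset {A : Set (E d)} (hA : IsCompact A) (hne : A.Nonempty) {v : E d}
    (h : ∀ x ∈ A, v + x ∈ A) : v = 0 := by
  obtain ⟨a, ha, hmax⟩ := hA.exists_isMaxOn hne (f := fun x => ⟪v, x⟫_ℝ) (by fun_prop)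
  have h1 : ⟪v, v + a⟫_ℝ ≤ ⟪v, a⟫_ℝ := hmax (h a ha)
  rw [inner_add_right] at h1
  have h2 : ⟪v, v⟫_ℝ ≤ 0 := by linarith
  exact real_inner_self_nonpos.1 h2

lemma eq_of_vadd_eq_vadd {A : Set (E d)} (hA : IsCompact A) (hne : A.Nonempty) {v w : E d}
    (h : v +ᵥ A = w +ᵥ A) : v = w := by
  rw [← sub_eq_zero]
  refine eq_zero_of_vadd_subset hA hne fun x hx => ?_
  have h1 : v +ᵥ x ∈ w +ᵥ A := h ▸ Set.vadd_mem_vadd_set hx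
  rw [Set.mem_vadd_set_iff_neg_vadd_mem] at h1
  convert h1 using 1
  simp only [vadd_eq_add]
  abel

/-- The face of `A` on which the scalar product with `m` is maximal. -/
def maxFace (m : E d) (A : Set (E d)) : Set (E d) := {x ∈ A | ∀ y ∈ A, ⟪m, y⟫_ℝ ≤ ⟪m, x⟫_ℝ}

lemma maxFace_vadd (m v : E d) (A : Set (E d)) : maxFace m (v +ᵥ A) = v +ᵥ maxFace m A := by
  ext x
  rw [Set.mem_vadd_set_iff_neg_vadd_mem]
  constructor
  · rintro ⟨h1, h2⟩
    refine ⟨Set.mem_vadd_set_iff_neg_vadd_mem.1 h1, fun y hy => ?_⟩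
    have := h2 (v +ᵥ y) (Set.vadd_mem_vadd_set hy)
    rw [vadd_eq_add, inner_add_right] at *
    rw [inner_neg_right]
    linarith
  · rintro ⟨h1, h2⟩
    refine ⟨Set.mem_vadd_set_iff_neg_vadd_mem.2 h1, ?_⟩
    rintro _ ⟨y, hy, rfl⟩
    have := h2 y hy
    simp only [vadd_eq_add, inner_add_right, inner_neg_right] at *
    linarith

lemma isExposed_maxFace (m : E d) (A : Set (E d)) : IsExposed ℝ A (maxFace m A) :=
  fun _ => ⟨innerSL ℝ m, rfl⟩

lemma dim_vadd (v : E d) (F : Set (E d)) : dim (v +ᵥ F) = dim F := by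
  rw [dim, vectorSpan_vadd, dim]

lemma IsUnitNormal.vadd {A B : Set (E d)} {n : E d} (h : IsUnitNormal A B n) (v : E d) :
    IsUnitNormal (v +ᵥ A) (v +ᵥ B) n := by
  refine ⟨h.1, ?_, ?_⟩
  · rw [← Set.vadd_set_inter, vectorSpan_vadd]
    exact h.2.1
  · rintro _ ⟨a, ha, rfl⟩ _ ⟨b, hb, rfl⟩
    simp only [vadd_eq_add, inner_add_right]
    linarith [h.2.2 a ha b hb]

/-- The group of translations that preserve the tiling. -/
def translationGroup (T : Set (Set (E d))) : AddSubgroup (E d) where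
  carrier := {v | ∀ A ∈ T, v +ᵥ A ∈ T ∧ -v +ᵥ A ∈ T}
  add_mem' := by
    intro v w hv hw A hA
    rw [neg_add, add_vadd, add_vadd]
    exact ⟨(hv _ (hw A hA).1).1, (hv _ (hw A hA).2).2⟩
  zero_mem' := by
    intro A hA
    simpa using hA
  neg_mem' := by
    intro v hv A hA
    rw [neg_neg]
    exact (hv A hA).symm

section Tiling

variable {P : Set (E d)} {T : Set (Set (E d))} {A B C : Set (E d)} {s : Set (E d) → ℝ}

lemma vadd_mem_of_mem {v : E d} (hv : v ∈ translationGroup T) (hA : A ∈ T) : v +ᵥ A ∈ T :=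
  (hv A hA).1

lemma image_vadd_eq {v : E d} (hv : v ∈ translationGroup T) :
    (fun A : Set (E d) => v +ᵥ A) '' T = T := by
  ext A
  constructor
  · rintro ⟨B, hB, rfl⟩
    exact (hv B hB).1
  · intro hA
    exact ⟨-v +ᵥ A, (hv A hA).2, by simp⟩

namespace IsParallelohedralTiling

lemma adjacent_vadd (hT : IsParallelohedralTiling P T) {v : E d} (hv : v ∈ translationGroup T)
    (h : Adjacent T A B) : Adjacent T (v +ᵥ A) (v +ᵥ B) := by
  refine hT.adjacent_of_le_dim (vadd_mem_of_mem hv h.1) (vadd_mem_of_mem hv h.2.1) ?_ ?_ ?_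
  · exact fun heq => h.2.2.1 (vadd_left_cancel v heq)
  · rw [← Set.vadd_set_inter]
    exact h.nonempty.vadd_set
  · rw [← Set.vadd_set_inter, dim_vadd]
    exact h.dim_eq.ge

lemma affineEval_jump_vadd (hT : IsParallelohedralTiling P T) (hinv : IsTranslationInvariant T s)
    {v : E d} (hv : v ∈ translationGroup T) (h : Adjacent T A B) (x : E d) :
    affineEval (jump s (v +ᵥ A) (v +ᵥ B)) (v + x) = affineEval (jump s A B) x := by
  obtain ⟨n, hn, -⟩ := hT.exists_isUnitNormal_eq h
  obtain ⟨w, hw⟩ := h.nonempty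
  rw [hT.affineEval_jump h hn hw, hT.affineEval_jump (hT.adjacent_vadd hv h) (hn.vadd v)
    (w := v +ᵥ w) (by rw [← Set.vadd_set_inter]; exact Set.vadd_mem_vadd_set hw),
    ← Set.vadd_set_inter, hinv v (image_vadd_eq hv) _ h.2.2.2, vadd_eq_add, inner_add_right,
    inner_add_right]
  ring

lemma exists_vadd_eq (hT : IsParallelohedralTiling P T) (hA : A ∈ T) (hB : B ∈ T) :
    ∃ v : E d, B = v +ᵥ A := by
  obtain ⟨a, rfl⟩ := hT.translates A hA
  obtain ⟨b, rfl⟩ := hT.translates B hB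
  exact ⟨b - a, by rw [vadd_vadd, sub_add_cancel]⟩

/-- The facet of `C` with outer normal `n` leads to a neighbour `t' +ᵥ C`. Both `t` and `t'` carry
the face of `C` with normal `-n` onto the one with normal `n`, and a nonempty compact set determines
such a translation. -/
lemma vadd_mem_of_adjacent (hT : IsParallelohedralTiling P T) {t : E d}
    (h : Adjacent T A (t +ᵥ A)) (hC : C ∈ T) : t +ᵥ C ∈ T := by
  obtain ⟨v, rfl⟩ := hT.exists_vadd_eq h.1 hC
  obtain ⟨n, hn, hF⟩ := hT.exists_isUnitNormal_eq h
  have hF' : A ∩ (t +ᵥ A) = maxFace n A := hF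
  have hne := h.nonempty
  have hdim := h.dim_eq
  rw [hF'] at hne hdim
  obtain ⟨B, hadj, hB⟩ := hT.exists_adjacent hC (isExposed_maxFace n (v +ᵥ A))
    (by rw [maxFace_vadd]; exact hne.vadd_set) (by rw [maxFace_vadd, dim_vadd]; exact hdim)
  obtain ⟨t', rfl⟩ := hT.exists_vadd_eq hC hadj.2.1
  obtain ⟨m, hm, -⟩ := hT.exists_isUnitNormal_eq hadj
  have hnB : n ∈ (vectorSpan ℝ ((v +ᵥ A) ∩ (t' +ᵥ (v +ᵥ A))))ᗮ := by
    rw [hB]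
    exact mem_orthogonal_of_eq rfl
  have hmn : m = n := by
    rcases eq_or_eq_neg_of_mem_orthogonal hadj.dim_eq.ge hm.1 hn.1 hm.2.1 hnB with h1 | h1
    · exact h1
    · obtain ⟨w, hw⟩ := hadj.nonempty
      have hw' := hw
      rw [hB] at hw'
      refine (hT.not_const hC hn.1 hw'.2 fun x hx => ?_).elim
      have := hm.2.2 x hx w hw.2
      rwa [h1, inner_neg_left, inner_neg_left, neg_le_neg_iff] at this
  rw [hmn] at hm
  have h1 : maxFace n A = t +ᵥ maxFace (-n) A := by
    rw [← maxFace_vadd, ← hF', Set.inter_comm]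
    exact hT.inter_eq_of_isUnitNormal h.symm hn.neg
  have h2 : v +ᵥ maxFace n A = t' +ᵥ (v +ᵥ maxFace (-n) A) := by
    rw [← maxFace_vadd, ← maxFace_vadd, ← maxFace_vadd, ← hB, Set.inter_comm]
    exact hT.inter_eq_of_isUnitNormal hadj.symm hm.neg
  have h3 : t = t' := by
    rw [h1] at hne
    refine eq_of_vadd_eq_vadd (A := v +ᵥ maxFace (-n) A) ?_ ?_ ?_
    · exact (((isExposed_maxFace (-n) A).isCompact (hT.isCompact h.1))).vadd v
    · exact (Set.vadd_set_nonempty.1 hne).vadd_set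
    · rw [← h2, h1, vadd_vadd, vadd_vadd, add_comm]
  rw [h3]
  exact hadj.2.1

lemma mem_translationGroup_of_adjacent (hT : IsParallelohedralTiling P T) {t : E d}
    (h : Adjacent T A (t +ᵥ A)) : t ∈ translationGroup T := by
  intro C hC
  refine ⟨hT.vadd_mem_of_adjacent h hC, hT.vadd_mem_of_adjacent (A := t +ᵥ A) ?_ hC⟩
  rw [neg_vadd_vadd]
  exact h.symm

/-- The tiling is a lattice tiling. -/
lemma exists_translation (hT : IsParallelohedralTiling P T) (hA : A ∈ T) (hB : B ∈ T) :
    ∃ v ∈ translationGroup T, B = v +ᵥ A := by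
  refine hT.forall_of_adjacent_univ (fun C => ∃ v ∈ translationGroup T, C = v +ᵥ A) ?_ hA
    ⟨0, zero_mem _, by simp⟩ hB
  rintro C D hCD ⟨v, hv, rfl⟩
  obtain ⟨t, rfl⟩ := hT.exists_vadd_eq hCD.1 hCD.2.1
  exact ⟨t + v, add_mem (hT.mem_translationGroup_of_adjacent hCD) hv, by rw [vadd_vadd]⟩

lemma vadd_left_injective (hT : IsParallelohedralTiling P T) (hA : A ∈ T) {v w : E d}
    (h : v +ᵥ A = w +ᵥ A) : v = w := eq_of_vadd_eq_vadd (hT.isCompact hA) (hT.nonempty hA) h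

lemma discreteTopology (hT : IsParallelohedralTiling P T) (hA : A ∈ T) :
    DiscreteTopology (AddSubgroup.toIntSubmodule (translationGroup T)) := by
  refine discreteTopology_of_isOpen_singleton_zero ?_
  obtain ⟨p, hp⟩ := hT.interior_nonempty hA
  obtain ⟨ε, hε, hb⟩ := Metric.isOpen_iff.1 isOpen_interior p hp
  rw [Metric.isOpen_iff]
  rintro _ rfl
  refine ⟨ε, hε, fun v hv => ?_⟩
  have hv' : ‖(v : E d)‖ < ε := by simpa using hv
  have h1 : (v : E d) +ᵥ p ∈ interior A := by
    apply hb
    rw [Metric.mem_ball, dist_eq_norm, vadd_eq_add, add_sub_cancel_right]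
    exact hv'
  have h2 : (v : E d) +ᵥ A = A := hT.eq_of_mem_interior (vadd_mem_of_mem v.2 hA) hA
    (Set.vadd_mem_vadd_set (interior_subset hp)) h1
  have h3 : (v : E d) = 0 := hT.vadd_left_injective hA (by rw [h2, zero_vadd])
  exact Subtype.ext h3

lemma exists_sub_mem (hT : IsParallelohedralTiling P T) (hA : A ∈ T) (x : E d) :
    ∃ v ∈ translationGroup T, ∃ y ∈ A, x = v + y := by
  obtain ⟨B, hB, hx⟩ := hT.exists_mem x
  obtain ⟨v, hv, rfl⟩ := hT.exists_translation hA hB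
  obtain ⟨y, hy, rfl⟩ := hx
  exact ⟨v, hv, y, hy, rfl⟩

/-- If `x` is orthogonal to the lattice, each multiple `N • x`, being a lattice vector plus a point
of `A`, has bounded product with `x`. -/
lemma span_translationGroup (hT : IsParallelohedralTiling P T) (hA : A ∈ T) :
    Submodule.span ℝ (translationGroup T : Set (E d)) = ⊤ := by
  rw [← Submodule.orthogonal_eq_bot_iff, Submodule.eq_bot_iff]
  intro x hx
  obtain ⟨M, hM⟩ := (hT.isCompact hA).isBounded.exists_norm_le
  by_contra hx0
  have hpos : 0 < ‖x‖ := norm_pos_iff.2 hx0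
  obtain ⟨N, hN⟩ := exists_nat_gt (M / ‖x‖)
  obtain ⟨v, hv, y, hy, hxy⟩ := hT.exists_sub_mem hA ((N : ℝ) • x)
  have h1 : ⟪x, v⟫_ℝ = 0 := by
    rw [real_inner_comm]
    exact (Submodule.mem_orthogonal _ _).1 hx v (Submodule.subset_span hv)
  have h2 : (N : ℝ) * ‖x‖ ^ 2 = ⟪x, y⟫_ℝ := by
    rw [← real_inner_self_eq_norm_sq, ← inner_smul_right, hxy, inner_add_right, h1, zero_add]
  have h3 : ⟪x, y⟫_ℝ ≤ ‖x‖ * M :=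
    (real_inner_le_norm x y).trans (mul_le_mul_of_nonneg_left (hM y hy) hpos.le)
  rw [div_lt_iff₀ hpos] at hN
  nlinarith

end IsParallelohedralTiling

end Tiling

/-- Additive functions on a full lattice extend to linear functions. -/
lemma exists_linearMap_extending (Λ : Submodule ℤ (E d)) [DiscreteTopology Λ] [IsZLattice ℝ Λ]
    {W : Type*} [AddCommGroup W] [Module ℝ W] (φ : Λ →+ W) :
    ∃ L : E d →ₗ[ℝ] W, ∀ v : Λ, L v = φ v := by
  have : Module.Free ℤ Λ := ZLattice.module_free ℝ Λ
  let b := Module.Free.chooseBasis ℤ Λ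
  let L : E d →ₗ[ℝ] W := (b.ofZLatticeBasis ℝ Λ).constr ℝ fun i => φ (b i)
  have h : (L.restrictScalars ℤ).comp Λ.subtype = φ.toIntLinearMap := by
    refine b.ext fun i => ?_
    have := (b.ofZLatticeBasis ℝ Λ).constr_basis ℝ (fun i => φ (b i)) i
    rw [Module.Basis.ofZLatticeBasis_apply] at this
    exact this
  exact ⟨L, fun v => LinearMap.congr_fun h v⟩

/-! ### The quadratic form -/

section Tiling

variable {P P₀ : Set (E d)} {T : Set (Set (E d))} {A B C : Set (E d)} {s : Set (E d) → ℝ}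
  {Φ : Set (E d) → E d × ℝ}

namespace IsParallelohedralTiling

/-- The potential and its translate by `v` have the same jumps, so they differ by one affine
function, which is found at `P₀`, where `Φ` vanishes. -/
lemma affineEval_vadd (hT : IsParallelohedralTiling P T) (hinv : IsTranslationInvariant T s)
    (hΦ : IsPotential T s Φ) (hP₀ : P₀ ∈ T) (hΦ₀ : Φ P₀ = 0) {v : E d}
    (hv : v ∈ translationGroup T) (hA : A ∈ T) (x : E d) :
    affineEval (Φ (v +ᵥ A)) (v + x) =
      affineEval (Φ A) x + affineEval (Φ (v +ᵥ P₀)) (v + x) := by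
  refine hT.forall_of_adjacent_univ (fun C => affineEval (Φ (v +ᵥ C)) (v + x) =
      affineEval (Φ C) x + affineEval (Φ (v +ᵥ P₀)) (v + x)) ?_ hP₀ ?_ hA
  · intro C D hCD h
    have h1 := affineEval_sub (Φ D) (Φ C) x
    have h2 := affineEval_sub (Φ (v +ᵥ D)) (Φ (v +ᵥ C)) (v + x)
    rw [hΦ _ _ hCD] at h1
    rw [hΦ _ _ (hT.adjacent_vadd hv hCD), hT.affineEval_jump_vadd hinv hv hCD] at h2
    linarith
  · simp [hΦ₀, affineEval]

/-- Convexity presents `P₀` as an intersection of half-spaces indexed by the lattice; central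
symmetry and definiteness of the form both come from this description. -/
lemma mem_iff_affineEval_nonpos (hT : IsParallelohedralTiling P T) (hs : IsCanonicalScaling T s)
    (hΦ : IsPotential T s Φ) (hP₀ : P₀ ∈ T) (hΦ₀ : Φ P₀ = 0) {x : E d} :
    x ∈ P₀ ↔ ∀ v ∈ translationGroup T, affineEval (Φ (v +ᵥ P₀)) x ≤ 0 := by
  have h0 : affineEval (Φ P₀) x = 0 := by simp [hΦ₀, affineEval]
  constructor
  · intro hx v hv
    rw [← h0]
    exact hT.affineEval_le hs hΦ hP₀ (vadd_mem_of_mem hv hP₀) hx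
  · intro h
    by_contra hx
    obtain ⟨A, hA, hxA⟩ := hT.exists_mem x
    obtain ⟨v, hv, rfl⟩ := hT.exists_translation hP₀ hA
    have h1 := hT.affineEval_lt hs hΦ hA hP₀ hxA hx
    have h2 := h v hv
    linarith

/-- The gradients of the lifted tiles depend linearly on the translation, and the affine
functions on the tiles are tangents of a positive definite quadratic form. -/
theorem exists_quadratic (hT : IsParallelohedralTiling P T) (hs : IsCanonicalScaling T s)
    (hinv : IsTranslationInvariant T s) (hΦ : IsPotential T s Φ) (hP₀ : P₀ ∈ T)
    (hΦ₀ : Φ P₀ = 0) :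
    ∃ (L : E d →ₗ[ℝ] E d) (c : E d), L.IsSymmetric ∧ (∀ x, x ≠ 0 → 0 < ⟪L x, x⟫_ℝ) ∧
      (∀ v ∈ translationGroup T, (Φ (v +ᵥ P₀)).1 = L v) ∧
      ∀ v ∈ translationGroup T, ∀ x, affineEval (Φ (v +ᵥ P₀)) x =
        ⟪L v, x - c⟫_ℝ - 1 / 2 * ⟪L v, v⟫_ℝ := by
  set Λ := AddSubgroup.toIntSubmodule (translationGroup T) with hΛ
  have hdisc : DiscreteTopology Λ := hT.discreteTopology hP₀
  have hspan := hT.span_translationGroup hP₀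
  have hlat : IsZLattice ℝ Λ := ⟨hspan⟩
  have hcoc : ∀ v ∈ translationGroup T, ∀ w ∈ translationGroup T, ∀ x,
      affineEval (Φ ((v + w) +ᵥ P₀)) (v + x) =
        affineEval (Φ (w +ᵥ P₀)) x + affineEval (Φ (v +ᵥ P₀)) (v + x) := by
    intro v hv w hw x
    rw [add_vadd]
    exact hT.affineEval_vadd hinv hΦ hP₀ hΦ₀ hv (vadd_mem_of_mem hw hP₀) x
  have hadd : ∀ v ∈ translationGroup T, ∀ w ∈ translationGroup T,
      (Φ ((v + w) +ᵥ P₀)).1 = (Φ (v +ᵥ P₀)).1 + (Φ (w +ᵥ P₀)).1 := by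
    intro v hv w hw
    refine ext_inner_right ℝ fun x => ?_
    have h1 := hcoc v hv w hw x
    have h2 := hcoc v hv w hw 0
    simp only [affineEval, inner_add_right, inner_zero_right, inner_add_left] at *
    linarith
  have hconst : ∀ v ∈ translationGroup T, ∀ w ∈ translationGroup T,
      (Φ ((v + w) +ᵥ P₀)).2 =
        (Φ (v +ᵥ P₀)).2 + (Φ (w +ᵥ P₀)).2 - ⟪(Φ (w +ᵥ P₀)).1, v⟫_ℝ := by
    intro v hv w hw
    have h2 := hcoc v hv w hw 0
    simp only [affineEval, hadd v hv w hw, inner_add_right, inner_zero_right,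
      inner_add_left] at h2
    linarith
  -- The left side of `hconst` is symmetric in `v` and `w`, hence so is the cross term.
  have hsymm : ∀ v ∈ translationGroup T, ∀ w ∈ translationGroup T,
      ⟪(Φ (w +ᵥ P₀)).1, v⟫_ℝ = ⟪(Φ (v +ᵥ P₀)).1, w⟫_ℝ := by
    intro v hv w hw
    have h1 := hconst v hv w hw
    have h2 := hconst w hw v hv
    rw [add_comm w v] at h2
    linarith
  obtain ⟨L, hL⟩ := exists_linearMap_extending Λ
    (AddMonoidHom.mk' (fun v : Λ => (Φ ((v : E d) +ᵥ P₀)).1)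
      fun v w => hadd v v.2 w w.2)
  have hL' : ∀ v ∈ translationGroup T, (Φ (v +ᵥ P₀)).1 = L v := fun v hv =>
    (hL ⟨v, hv⟩).symm
  -- Adding `½ ⟪L v, v⟫` cancels the cross term of `hconst` and leaves an additive function.
  obtain ⟨l, hl⟩ := exists_linearMap_extending Λ
    (AddMonoidHom.mk' (fun v : Λ => (Φ ((v : E d) +ᵥ P₀)).2 + 1 / 2 * ⟪L v, (v : E d)⟫_ℝ) (by
      rintro ⟨v, hv⟩ ⟨w, hw⟩
      have h1 := hconst v hv w hw
      have h2 := hsymm v hv w hw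
      rw [hL' v hv, hL' w hw] at h2
      rw [hL' w hw] at h1
      simp only [Submodule.coe_add, map_add, inner_add_left, inner_add_right]
      rw [h1, h2]
      linarith))
  have hl' : ∀ v ∈ translationGroup T, (Φ (v +ᵥ P₀)).2 = l v - 1 / 2 * ⟪L v, v⟫_ℝ :=
    fun v hv => by
      have : l v = (Φ (v +ᵥ P₀)).2 + 1 / 2 * ⟪L v, v⟫_ℝ := hl ⟨v, hv⟩
      linarith
  have hzero : ∀ f : E d →ₗ[ℝ] ℝ, (∀ v ∈ translationGroup T, f v = 0) → f = 0 := fun f hf =>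
    LinearMap.ext_on hspan fun v hv => by simpa using hf v hv
  have hLsymm : L.IsSymmetric := by
    have h1 : ∀ w ∈ translationGroup T, ∀ x, ⟪L x, w⟫_ℝ = ⟪x, L w⟫_ℝ := by
      intro w hw x
      have h2 := hzero ((innerₗ (E d) w).comp L - innerₗ (E d) (L w)) fun v hv => by
        have := hsymm v hv w hw
        rw [hL' v hv, hL' w hw] at this
        simp [this, real_inner_comm]
      have h3 := LinearMap.congr_fun h2 x
      simp only [LinearMap.sub_apply, LinearMap.comp_apply, innerₗ_apply_apply,
        LinearMap.zero_apply] at h3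
      rw [real_inner_comm, real_inner_comm (L w) x]
      linarith
    intro x y
    have h2 := hzero (innerₗ (E d) (L x) - (innerₗ (E d) x).comp L) fun v hv => by
      simp [h1 v hv x]
    have h3 := LinearMap.congr_fun h2 y
    simp only [LinearMap.sub_apply, LinearMap.comp_apply, innerₗ_apply_apply,
      LinearMap.zero_apply] at h3
    linarith
  have hLcont : Continuous L := L.continuous_of_finiteDimensional
  -- The piece of `v +ᵥ P₀` is at most zero at `x ∈ P₀` and at least zero at `v + x`; the difference
  -- of the two values is `⟪L v, v⟫`.
  have hΛnonneg : ∀ v ∈ translationGroup T, 0 ≤ ⟪L v, v⟫_ℝ := by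
    intro v hv
    obtain ⟨x, hx⟩ := hT.nonempty hP₀
    have h1 := (hT.mem_iff_affineEval_nonpos hs hΦ hP₀ hΦ₀).1 hx v hv
    have h2 := hT.affineEval_le hs hΦ (vadd_mem_of_mem hv hP₀) hP₀ (x := v +ᵥ x)
      (Set.vadd_mem_vadd_set hx)
    simp only [hΦ₀, affineEval, vadd_eq_add, inner_add_right, Prod.fst_zero, inner_zero_left,
      Prod.snd_zero, hL' v hv] at h1 h2
    linarith
  have hnonneg : ∀ x, 0 ≤ ⟪L x, x⟫_ℝ := by
    intro x
    obtain ⟨M₁, hM₁⟩ := (hT.isCompact hP₀).exists_bound_of_continuousOn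
      (f := fun y => ⟪L x, y⟫_ℝ) (by fun_prop)
    obtain ⟨M₂, hM₂⟩ := (hT.isCompact hP₀).exists_bound_of_continuousOn
      (f := fun y => ⟪L y, y⟫_ℝ) (by fun_prop)
    by_contra! hneg
    -- With `N • x = v + y`, `y ∈ P₀`, the number `⟪L v, v⟫ ≥ 0` is `N² ⟪L x, x⟫` up to an error of
    -- at most `2 N M₁ + M₂`, so this `N` is too large for `⟪L x, x⟫ < 0`.
    obtain ⟨N, hN⟩ := exists_nat_gt ((2 * M₁ + M₂) / (-⟪L x, x⟫_ℝ) + 1)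
    obtain ⟨v, hv, y, hy, hxy⟩ := hT.exists_sub_mem hP₀ ((N : ℝ) • x)
    have hv' : v = (N : ℝ) • x - y := by rw [hxy, add_sub_cancel_right]
    have h1 := hΛnonneg v hv
    have h2 := hM₁ y hy
    have h3 := hM₂ y hy
    rw [Real.norm_eq_abs, abs_le] at h2 h3
    have h4 : ⟪L y, x⟫_ℝ = ⟪L x, y⟫_ℝ := by rw [hLsymm, real_inner_comm]
    rw [hv', map_sub, map_smul] at h1
    simp only [inner_sub_left, inner_sub_right, real_inner_smul_left, inner_smul_right, h4] at h1
    have h5 : 0 ≤ 2 * M₁ + M₂ := by linarith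
    have h6 : (2 * M₁ + M₂) / (-⟪L x, x⟫_ℝ) < N - 1 := by linarith
    rw [div_lt_iff₀ (by linarith)] at h6
    have h7 : (1 : ℝ) ≤ N := by
      have : 0 ≤ (2 * M₁ + M₂) / (-⟪L x, x⟫_ℝ) := div_nonneg h5 (by linarith)
      linarith
    nlinarith
  have hpos : ∀ x, x ≠ 0 → 0 < ⟪L x, x⟫_ℝ := by
    intro x hx
    refine lt_of_le_of_ne (hnonneg x) fun h0 => hx ?_
    have hLx : L x = 0 := by
      -- The form at `x + t • L x` is a nonnegative quadratic in `t` without constant term, so its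
      -- linear coefficient vanishes.
      have h1 : ∀ t : ℝ, 0 ≤ ⟪L (L x), L x⟫_ℝ * (t * t) + (2 * ⟪L x, L x⟫_ℝ) * t + 0 := by
        intro t
        have h2 := hnonneg (x + t • L x)
        have h3 : ⟪L (L x), x⟫_ℝ = ⟪L x, L x⟫_ℝ := hLsymm _ _
        simp only [map_add, map_smul, inner_add_left, inner_add_right, real_inner_smul_left,
          inner_smul_right, ← h0, h3] at h2
        linarith
      have h4 := discrim_le_zero h1
      rw [discrim, mul_zero, sub_zero] at h4
      have h5 : 2 * ⟪L x, L x⟫_ℝ = 0 := by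
        rw [← sq_nonpos_iff]
        exact h4
      exact inner_self_eq_zero (𝕜 := ℝ).1 (by linarith)
    -- Translation by a kernel vector of `L` changes none of the inequalities defining the bounded
    -- set `P₀`.
    refine eq_zero_of_vadd_subset (hT.isCompact hP₀) (hT.nonempty hP₀) fun y hy => ?_
    rw [hT.mem_iff_affineEval_nonpos hs hΦ hP₀ hΦ₀] at hy ⊢
    intro v hv
    have h1 := hy v hv
    have h2 : ⟪L v, x⟫_ℝ = 0 := by rw [hLsymm, hLx, inner_zero_right]
    simp only [affineEval, hL' v hv, inner_add_right, h2] at h1 ⊢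
    linarith
  have hsurj : Function.Surjective L := by
    refine LinearMap.injective_iff_surjective.1 ((injective_iff_map_eq_zero L).2 fun x hx => ?_)
    by_contra h0
    have := hpos x h0
    rw [hx, inner_zero_left] at this
    exact lt_irrefl _ this
  set m := (InnerProductSpace.toDual ℝ (E d)).symm l.toContinuousLinearMap with hm
  obtain ⟨c, hc⟩ := hsurj (-m)
  refine ⟨L, c, hLsymm, hpos, hL', fun v hv x => ?_⟩
  have h1 : l v = -⟪L v, c⟫_ℝ := by
    rw [hLsymm, hc, inner_neg_right, neg_neg, real_inner_comm, hm,
      InnerProductSpace.toDual_symm_apply]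
    rfl
  rw [affineEval, hL' v hv, hl' v hv, h1, inner_sub_right]
  ring

end IsParallelohedralTiling

/-! ### Centres of symmetry -/

/-- The composition of the two point reflections is translation by `2 (a - b)`. -/
lemma IsCenter.unique {A : Set (E d)} (hA : IsCompact A) (hne : A.Nonempty) {a b : E d}
    (ha : IsCenter A a) (hb : IsCenter A b) : a = b := by
  have h : (2 : ℝ) • (a - b) = 0 := by
    refine eq_zero_of_vadd_subset hA hne fun x hx => ?_
    convert ha _ (hb x hx) using 1
    module
  simpa [sub_eq_zero] using h

lemma IsCenter.vadd {A : Set (E d)} {a : E d} (ha : IsCenter A a) (v : E d) :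
    IsCenter (v +ᵥ A) (v + a) := by
  rintro _ ⟨x, hx, rfl⟩
  refine ⟨_, ha x hx, ?_⟩
  simp only [vadd_eq_add]
  abel

lemma IsCenter.mem_interior {A : Set (E d)} (hA : Convex ℝ A) (hne : (interior A).Nonempty)
    {a : E d} (ha : IsCenter A a) : a ∈ interior A := by
  obtain ⟨x, hx⟩ := hne
  have := hA.combo_interior_self_mem_interior hx (ha x (interior_subset hx))
    (a := 1 / 2) (b := 1 / 2) (by norm_num) (by norm_num) (by norm_num)
  convert this using 1
  module

/-! ### The generatrix -/

/-- The lift of a tile by an affine function. -/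
def liftBy (φ : E d × ℝ) (A : Set (E d)) : Set (E d × ℝ) := {p | p.1 ∈ A ∧ p.2 = affineEval φ p.1}

lemma fst_image_liftBy (φ : E d × ℝ) (A : Set (E d)) : Prod.fst '' liftBy φ A = A := by
  ext x
  constructor
  · rintro ⟨p, hp, rfl⟩
    exact hp.1
  · intro hx
    exact ⟨(x, affineEval φ x), ⟨hx, rfl⟩, rfl⟩

lemma isLift_liftBy (φ : E d × ℝ) (A : Set (E d)) : IsLift A (liftBy φ A) φ.1 := by
  refine ⟨fst_image_liftBy φ A, fun p hp q hq => ?_⟩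
  rw [hp.2, hq.2, affineEval, affineEval, inner_sub_right]
  ring

namespace IsParallelohedralTiling

lemma fst_add_smul_eq (hT : IsParallelohedralTiling P T) (hΦ : IsPotential T s Φ)
    (h : Adjacent T A B) {n : E d} (hn : IsUnitNormal A B n) :
    (Φ A).1 + s (A ∩ B) • n = (Φ B).1 := by
  obtain ⟨w, hw⟩ := h.nonempty
  have := congrArg Prod.fst (hΦ A B h)
  rw [hT.jump_eq h hn hw, Prod.fst_sub, sub_eq_iff_eq_add'] at this
  exact this.symm

/-- A lift is fixed by its normal and one point. Meeting the previous lift supplies a point over `A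
∩ B`, where `Φ A` and `Φ B` agree, so every chain leads to the same lift. -/
lemma eq_liftBy_of_genFace (hT : IsParallelohedralTiling P T) (hΦ : IsPotential T s Φ)
    (hP₀ : P₀ ∈ T) (hΦ₀ : Φ P₀ = 0) {L : Set (E d × ℝ)} {v : E d} (h : GenFace T s P₀ A L v) :
    A ∈ T ∧ L = liftBy (Φ A) A ∧ v = (Φ A).1 := by
  induction h with
  | base =>
    refine ⟨hP₀, ?_, by simp [hΦ₀]⟩
    ext p
    simp [liftBy, hΦ₀, affineEval]
  | @step A B L L' v n _ hAB hn hL' hmeet ih =>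
    obtain ⟨-, rfl, rfl⟩ := ih
    refine ⟨hAB.2.1, ?_, hT.fst_add_smul_eq hΦ hAB hn⟩
    rw [hT.fst_add_smul_eq hΦ hAB hn] at hL'
    obtain ⟨w, hw⟩ := hAB.nonempty
    have hw' := hw
    rw [← hmeet] at hw'
    obtain ⟨q, ⟨hqL, hqL'⟩, rfl⟩ := hw'
    have hq : q.2 = affineEval (Φ B) q.1 := by
      rw [hqL.2, hT.affineEval_eq_of_mem hΦ hAB.1 hAB.2.1 hw.1 hw.2]
    have hval : ∀ p ∈ L', p.2 = affineEval (Φ B) p.1 := by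
      intro p hp
      have h1 := hL'.2 p hp q hqL'
      rw [affineEval, inner_sub_right] at *
      linarith
    ext p
    constructor
    · intro hp
      exact ⟨hL'.1 ▸ ⟨p, hp, rfl⟩, hval p hp⟩
    · rintro ⟨hpB, hp⟩
      rw [← hL'.1] at hpB
      obtain ⟨p', hp', hpp'⟩ := hpB
      have : p' = p := Prod.ext hpp' (by rw [hval p' hp', hp, hpp'])
      rwa [← this]

lemma genFace_liftBy (hT : IsParallelohedralTiling P T) (hΦ : IsPotential T s Φ)
    (hP₀ : P₀ ∈ T) (hΦ₀ : Φ P₀ = 0) (hA : A ∈ T) :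
    GenFace T s P₀ A (liftBy (Φ A) A) (Φ A).1 := by
  refine hT.forall_of_adjacent_univ (fun C => GenFace T s P₀ C (liftBy (Φ C) C) (Φ C).1) ?_
    hP₀ ?_ hA
  · intro C D hCD h
    obtain ⟨n, hn, -⟩ := hT.exists_isUnitNormal_eq hCD
    have hfst := hT.fst_add_smul_eq hΦ hCD hn
    have := GenFace.step h hCD hn (L' := liftBy (Φ D) D)
      (by rw [hfst]; exact isLift_liftBy (Φ D) D) (by
        ext x
        constructor
        · rintro ⟨p, ⟨hp1, hp2⟩, rfl⟩
          exact ⟨hp1.1, hp2.1⟩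
        · rintro ⟨hxC, hxD⟩
          exact ⟨(x, affineEval (Φ C) x), ⟨⟨hxC, rfl⟩, hxD,
            (hT.affineEval_eq_of_mem hΦ hCD.1 hCD.2.1 hxC hxD).symm⟩, rfl⟩)
    rwa [hfst] at this
  · have h1 : liftBy (Φ P₀) P₀ = P₀ ×ˢ {0} := by
      ext p
      simp [liftBy, hΦ₀, affineEval]
    rw [h1, hΦ₀]
    exact GenFace.base

lemma exists_height (hT : IsParallelohedralTiling P T) (hΦ : IsPotential T s Φ) :
    ∃ G : E d → ℝ, ∀ A ∈ T, ∀ x ∈ A, G x = affineEval (Φ A) x := by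
  choose t ht hxt using hT.exists_mem
  exact ⟨fun x => affineEval (Φ (t x)) x, fun A hA x hx =>
    hT.affineEval_eq_of_mem hΦ hA (ht x) hx (hxt x)⟩

lemma generatrix_eq (hT : IsParallelohedralTiling P T) (hΦ : IsPotential T s Φ)
    (hP₀ : P₀ ∈ T) (hΦ₀ : Φ P₀ = 0) {G : E d → ℝ}
    (hG : ∀ A ∈ T, ∀ x ∈ A, G x = affineEval (Φ A) x) :
    generatrix T s P₀ = {p | p.2 = G p.1} := by
  ext p
  constructor
  · rintro ⟨A, L, v, h, hp⟩
    obtain ⟨hA, rfl, rfl⟩ := hT.eq_liftBy_of_genFace hΦ hP₀ hΦ₀ h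
    exact hp.2.trans (hG A hA p.1 hp.1).symm
  · intro hp
    obtain ⟨A, hA, hxA⟩ := hT.exists_mem p.1
    exact ⟨A, _, _, hT.genFace_liftBy hΦ hP₀ hΦ₀ hA, hxA, hp.trans (hG A hA _ hxA)⟩

end IsParallelohedralTiling

end Tiling

/-! ### Gradients and positive definiteness -/

lemma hasGradientAt_affineEval (φ : E d × ℝ) (x : E d) :
    HasGradientAt (affineEval φ) φ.1 x := by
  rw [hasGradientAt_iff_hasFDerivAt]
  exact ((innerSL ℝ φ.1).hasFDerivAt).add_const φ.2

lemma hasGradientAt_quadForm {Q : Matrix (Fin d) (Fin d) ℝ}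
    (hQ : (Matrix.toEuclideanLin Q).IsSymmetric) (c x : E d) :
    HasGradientAt (fun y => quadForm Q (y - c)) (Matrix.toEuclideanLin Q (x - c)) x := by
  rw [hasGradientAt_iff_hasFDerivAt]
  let M : E d →L[ℝ] E d := (Matrix.toEuclideanLin Q).toContinuousLinearMap
  have h1 : HasFDerivAt (fun y : E d => y - c) (ContinuousLinearMap.id ℝ (E d)) x :=
    (hasFDerivAt_id x).sub_const c
  have h2 : HasFDerivAt (fun y : E d => M (y - c)) (M.comp (ContinuousLinearMap.id ℝ (E d))) x :=
    M.hasFDerivAt.comp x h1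
  refine ((h1.inner ℝ h2).const_mul (1 / 2)).congr_fderiv ?_
  ext y
  have h3 : ⟪y, Matrix.toEuclideanLin Q (x - c)⟫_ℝ = ⟪Matrix.toEuclideanLin Q (x - c), y⟫_ℝ :=
    real_inner_comm _ _
  have h4 : ⟪x - c, Matrix.toEuclideanLin Q y⟫_ℝ = ⟪Matrix.toEuclideanLin Q (x - c), y⟫_ℝ :=
    (hQ _ _).symm
  change 1 / 2 * (⟪x - c, Matrix.toEuclideanLin Q y⟫_ℝ + ⟪y, Matrix.toEuclideanLin Q (x - c)⟫_ℝ) =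
    ⟪Matrix.toEuclideanLin Q (x - c), y⟫_ℝ
  rw [h3, h4]
  ring

lemma posDef_of_inner_pos {Q : Matrix (Fin d) (Fin d) ℝ}
    (hQ : (Matrix.toEuclideanLin Q).IsSymmetric)
    (hpos : ∀ x, x ≠ 0 → 0 < ⟪Matrix.toEuclideanLin Q x, x⟫_ℝ) : Q.PosDef := by
  refine Matrix.PosDef.of_dotProduct_mulVec_pos (Matrix.isSymmetric_toEuclideanLin_iff.1 hQ)
    fun x hx => ?_
  have h := hpos (WithLp.toLp 2 x) fun h0 => hx (by simpa using h0)
  rw [EuclideanSpace.inner_eq_star_dotProduct] at h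
  simpa [dotProduct_comm] using h

end ParTiling

end

/-! ### The inscribed paraboloid -/

theorem mainTheorem5 (d : ℕ) (P : Set (E d)) (T : Set (Set (E d)))
    (hT : IsParallelohedralTiling P T) (s : Set (E d) → ℝ)
    (hs : IsCanonicalScaling T s) (hinv : IsTranslationInvariant T s)
    (P₀ : Set (E d)) (hP₀ : P₀ ∈ T) :
    ∃ (c : E d) (Q : Matrix (Fin d) (Fin d) ℝ) (G : E d → ℝ),
      -- `c` is the centre of the initial tile, which the paraboloid has as its vertex
      IsCenter P₀ c ∧
      -- the graph of the form is an elliptic paraboloid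
      Q.PosDef ∧
      -- `Q` maps each facet vector to the corresponding scaled facet normal
      (∀ A a n, Adjacent T P₀ A → IsCenter A a → IsUnitNormal P₀ A n →
        s (P₀ ∩ A) • n = Matrix.toEuclideanLin Q (a - c)) ∧
      -- the generatrix is the graph of `G`
      generatrix T s P₀ = {p | p.2 = G p.1} ∧
      -- the paraboloid is inscribed in the generatrix: it lies in the epigraph of `G`
      (∀ x, G x ≤ quadForm Q (x - c)) ∧
      -- they meet exactly above the centres of the tiles
      (∀ x, G x = quadForm Q (x - c) ↔ ∃ A ∈ T, IsCenter A x) ∧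
      -- each tile has a centre, and above it the two surfaces are tangent
      (∀ A ∈ T, ∃ x, IsCenter A x) ∧
      (∀ A ∈ T, ∀ x, IsCenter A x →
        HasGradientAt G (Matrix.toEuclideanLin Q (x - c)) x ∧
        HasGradientAt (fun y => quadForm Q (y - c)) (Matrix.toEuclideanLin Q (x - c)) x) := by
  obtain ⟨Φ, hΦ₀, hΦ⟩ := hT.exists_potential hs hP₀
  replace hΦ : IsPotential T s Φ := hΦ
  obtain ⟨L, c, hLsymm, hLpos, hLΦ, hval⟩ := hT.exists_quadratic hs hinv hΦ hP₀ hΦ₀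
  obtain ⟨G, hG⟩ := hT.exists_height hΦ
  obtain ⟨Q, rfl⟩ := Matrix.toEuclideanLin.surjective L
  -- The reflection in `c` exchanges the half-spaces belonging to `v` and `-v`.
  have hcenter : IsCenter P₀ c := by
    intro x hx
    rw [hT.mem_iff_affineEval_nonpos hs hΦ hP₀ hΦ₀] at hx ⊢
    intro v hv
    have h1 := hx (-v) (neg_mem hv)
    rw [hval _ (neg_mem hv)] at h1
    rw [hval v hv]
    simp only [map_neg, inner_neg_left, inner_neg_right, neg_neg, inner_sub_right,
      inner_add_right] at h1 ⊢
    linarith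
  have htile : ∀ A ∈ T, ∃ v ∈ translationGroup T, A = v +ᵥ P₀ ∧
      ∀ x, IsCenter A x ↔ x = v + c := by
    intro A hA
    obtain ⟨v, hv, rfl⟩ := hT.exists_translation hP₀ hA
    refine ⟨v, hv, rfl, fun x => ⟨fun hx => ?_, ?_⟩⟩
    · exact hx.unique (hT.isCompact hA) (hT.nonempty hA) (hcenter.vadd v)
    · rintro rfl
      exact hcenter.vadd v
  -- Completing the square: below the paraboloid, the gap over a tile is the form centred at that
  -- tile's own centre.
  have hgap : ∀ v ∈ translationGroup T, ∀ x ∈ v +ᵥ P₀,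
      G x = quadForm Q (x - c) - quadForm Q (x - (v + c)) := by
    intro v hv x hx
    rw [hG _ (vadd_mem_of_mem hv hP₀) x hx, hval v hv]
    have h1 : x - (v + c) = (x - c) - v := by abel
    have h2 : ⟪x - c, Matrix.toEuclideanLin Q v⟫_ℝ = ⟪Matrix.toEuclideanLin Q v, x - c⟫_ℝ :=
      real_inner_comm _ _
    have h3 : ⟪v, Matrix.toEuclideanLin Q (x - c)⟫_ℝ = ⟪Matrix.toEuclideanLin Q v, x - c⟫_ℝ :=
      (hLsymm _ _).symm
    have h4 : ⟪v, Matrix.toEuclideanLin Q v⟫_ℝ = ⟪Matrix.toEuclideanLin Q v, v⟫_ℝ :=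
      real_inner_comm _ _
    rw [h1]
    generalize x - c = z at *
    simp only [quadForm, map_sub, inner_sub_left, inner_sub_right] at h2 h3 h4 ⊢
    rw [h2, h3, h4]
    ring
  have hform : ∀ z, z ≠ 0 → 0 < quadForm Q z := fun z hz => by
    rw [quadForm, real_inner_comm]
    exact mul_pos (by norm_num) (hLpos z hz)
  have hform0 : quadForm Q (0 : E d) = 0 := by simp [quadForm]
  refine ⟨c, Q, G, hcenter, posDef_of_inner_pos hLsymm hLpos, ?_,
    hT.generatrix_eq hΦ hP₀ hΦ₀ hG, fun x => ?_, fun x => ⟨fun h => ?_, ?_⟩, fun A hA => ?_,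
    fun A hA x hx => ⟨?_, hasGradientAt_quadForm hLsymm c x⟩⟩
  · intro A a n hadj ha hn
    obtain ⟨v, hv, rfl, hcen⟩ := htile A hadj.2.1
    rw [(hcen a).1 ha, add_sub_cancel_right, ← hLΦ v hv, ← hT.fst_add_smul_eq hΦ hadj hn, hΦ₀]
    simp
  · obtain ⟨A, hA, hxA⟩ := hT.exists_mem x
    obtain ⟨v, hv, rfl, -⟩ := htile A hA
    rw [hgap v hv x hxA]
    by_cases h0 : x - (v + c) = 0
    · rw [h0, hform0, sub_zero]
    · linarith [hform _ h0]
  · obtain ⟨A, hA, hxA⟩ := hT.exists_mem x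
    obtain ⟨v, hv, rfl, hcen⟩ := htile A hA
    refine ⟨_, hA, (hcen x).2 ?_⟩
    rw [hgap v hv x hxA] at h
    by_contra h0
    have := hform _ (sub_ne_zero.2 h0)
    linarith
  · rintro ⟨A, hA, hx⟩
    have hxA := interior_subset (hx.mem_interior (hT.convex hA) (hT.interior_nonempty hA))
    obtain ⟨v, hv, rfl, hcen⟩ := htile A hA
    rw [hgap v hv x hxA, sub_eq_zero.2 ((hcen x).1 hx), hform0, sub_zero]
  · obtain ⟨v, hv, rfl, hcen⟩ := htile A hA
    exact ⟨v + c, (hcen _).2 rfl⟩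
  · have hint := hx.mem_interior (hT.convex hA) (hT.interior_nonempty hA)
    obtain ⟨v, hv, rfl, hcen⟩ := htile A hA
    have h1 : Matrix.toEuclideanLin Q (x - c) = (Φ (v +ᵥ P₀)).1 := by
      rw [(hcen x).1 hx, add_sub_cancel_right, hLΦ v hv]
    rw [h1]
    refine (hasGradientAt_affineEval (Φ (v +ᵥ P₀)) x).congr_of_eventuallyEq ?_
    -- The centre is interior to its tile, so near it `G` is a single affine piece.
    filter_upwards [isOpen_interior.mem_nhds hint] with y hy
    exact hG _ hA y (interior_subset hy)
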